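/- Let \(h\) be a continuous, everywhere positive probability density on \([0,1]^2\) with \(h(z_1,z_2)=h(z_2,z_1)\) for all \(z_1,z_2\) and \(\int_0^1\int_0^1 z_1 h(z_1,z_2)\,dz_2\,dz_1=\tfrac12\), and let \(H\) be the distribution with density \(h\): the prior of the consumer's valuations \((Z_1,Z_2)\) for the products of two firms. Let \(\varphi\) be a real-valued function on \((0,1)\) (its values at \(0\) and \(1\) play no role) with \(\varphi(\tfrac12)=0\) and \(\lim_{z\downarrow 0}|\varphi'(z)|=\lim_{z\uparrow 1}|\varphi'(z)|=\infty\), such that \[c(x,y)=\varphi(x)+\varphi(1-x)+\varphi(y)+\varphi(1-y)\] is strictly convex and thrice differentiable on \((0,1)^2\), with \(c_{xxx}(x,y)\le 0\) for \(0<x\le\tfrac12\). For \(\kappa>0\) consider the following game. First, the consumer privately acquires a fusion \(F\) of \(H\), i.e. the distribution of the vector of posterior means \((\mathbb E[Z_1\mid s],\mathbb E[Z_2\mid s])\) induced by some signal \(s\) about \((Z_1,Z_2)\), at cost \(\kappa\int c\,dF\in[0,\infty]\). Then, without observing this, the firms simultaneously choose prices \(p_1,p_2\in\mathbb R\), possibly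 at random (independently, with finite means); marginal costs are zero. Finally, at posterior means \((x,y)\), the consumer buys from firm 1 if \(x-p_1>y-p_2\) and from firm 2 if \(x-p_1<y-p_2\) (ties are broken by an arbitrary measurable, possibly random, rule); there is no outside option. Her payoff is the posterior mean of the purchased product minus its price minus the cost of information, and each firm's payoff is its expected revenue. In an equilibrium, \(F\) maximizes the consumer's expected payoff over all fusions of \(H\) given the firms' price distributions, and each firm's price distribution maximizes its expected profit given \(F\), the purchase rule and the other firm's price distribution. For \(\lambda>0\) let \(\Gamma_\lambda\) be the distribution of prices on \([\sqrt2\,\lambda,(2+\sqrt2)\lambda]\) with distribution function \[\Gamma_\lambda(p)=\begin{cases}\dfrac{p-\sqrt2\,\lambda}{\lambda+p}, & \sqrt2\,\lambda\le p\le(1+\sqrt2)\lambda,\\[2mm] \dfrac{(3+\sqrt2)\lambda-2p}{\lambda-p}, & (1+\sqrt2)\lambda\le p\le(2+\sqrt2)\lambda.\end{cases}\] Then there is \(\bar\kappa>0\) (depending on \(h\) and \(\varphi\)) such that for every \(\kappa\ge\bar\kappa\) there is \(\lambda\in(0,1]\) for which, whatever the tie-breaking rule, the following is an equilibrium: the consumer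 comparison shops with uniform two-point support, i.e. acquires the fusion that puts probability \(\tfrac12\) on each of \(\left(\tfrac{1-\lambda}2,\tfrac{1+\lambda}2\right)\) and \(\left(\tfrac{1+\lambda}2,\tfrac{1-\lambda}2\right)\), and both firms randomize over prices according to \(\Gamma_\lambda\). -/

import Mathlib

open MeasureTheory ProbabilityTheory Set Filter Topology

noncomputable section

namespace CompShop

/-- The unit square of valuation vectors. -/
def square : Set (ℝ × ℝ) := Icc 0 1 ×ˢ Icc 0 1

/-! ### The prior -/

/-- `h` is a continuous, everywhere nonzero (hence positive) probability density on the unit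
square, symmetric about the diagonal, with mean `1/2` in each coordinate. -/
structure IsPriorDensity (h : ℝ × ℝ → ℝ) : Prop where
  continuousOn : ContinuousOn h square
  pos : ∀ z ∈ square, 0 < h z
  symm : ∀ z ∈ square, h (z.2, z.1) = h z
  total : ∫ z in square, h z = 1
  mean : ∫ z in square, z.1 * h z = 1 / 2

/-- The prior on the unit square with density `h`. -/
def prior (h : ℝ × ℝ → ℝ) : Measure (ℝ × ℝ) :=
  (volume.restrict square).withDensity (fun z => ENNReal.ofReal (h z))

/-! ### Learning -/

/-- `F` is a fusion of the prior `H`: there is a signal (a Markov kernel `K` from valuation vectors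
to some space of signal realizations `S`) such that `F` is the law of the vector of posterior means
`(E[Z₁ | s], E[Z₂ | s])` when `Z ~ H` and `s ~ K(Z, ·)`. -/
def IsFusion (H F : Measure (ℝ × ℝ)) : Prop :=
  ∃ (S : Type) (mS : MeasurableSpace S) (K : Kernel (ℝ × ℝ) S), IsMarkovKernel K ∧
    F = (H ⊗ₘ K).map (fun w : (ℝ × ℝ) × S =>
      (((H ⊗ₘ K)[fun w : (ℝ × ℝ) × S => w.1.1 | MeasurableSpace.comap Prod.snd mS]) w,
       ((H ⊗ₘ K)[fun w : (ℝ × ℝ) × S => w.1.2 | MeasurableSpace.comap Prod.snd mS]) w))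

/-- The cost integrand `c(x,y) = φ(x) + φ(1-x) + φ(y) + φ(1-y)`. -/
def cost (φ : ℝ → ℝ) (v : ℝ × ℝ) : ℝ :=
  φ v.1 + φ (1 - v.1) + φ v.2 + φ (1 - v.2)

/-- The assumptions on the cost integrand. They only concern the interior of the unit square; a
fusion of a prior with a density gives the boundary of the square probability zero, so the values
of `φ` at `0` and `1` (finite or not) never matter. As `c` is additively separable and symmetric,
being thrice differentiable in the first coordinate is the same as being thrice differentiable.
The sign condition `c_xxx ≤ 0` is on the half `x ≤ 1/2`: `c` is unchanged under `x ↦ 1 - x`, so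
`c_xxx` is odd about `x = 1/2`. -/
structure IsCostShape (φ : ℝ → ℝ) : Prop where
  strictConvex : StrictConvexOn ℝ (Ioo (0 : ℝ) 1 ×ˢ Ioo (0 : ℝ) 1) (cost φ)
  thriceDifferentiable : ∀ k < 3, ∀ x ∈ Ioo (0 : ℝ) 1, ∀ y ∈ Ioo (0 : ℝ) 1,
    DifferentiableAt ℝ (iteratedDeriv k (fun s => cost φ (s, y))) x
  half : φ (1 / 2) = 0
  slope_zero : Tendsto (fun z => |deriv φ z|) (𝓝[>] 0) atTop
  slope_one : Tendsto (fun z => |deriv φ z|) (𝓝[<] 1) atTop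
  third_nonpos : ∀ x ∈ Ioc (0 : ℝ) (1 / 2), ∀ y ∈ Ioo (0 : ℝ) 1,
    iteratedDeriv 3 (fun s => cost φ (s, y)) x ≤ 0

/-! ### The game -/

/-- A purchase rule: `σ v p` is the probability with which the consumer buys from firm 1 at the
vector `v = (x, y)` of posterior means and the prices `p = (p₁, p₂)`; otherwise she buys from
firm 2. She buys from the firm giving the higher net value; ties may be broken in any way. -/
structure IsPurchaseRule (σ : ℝ × ℝ → ℝ × ℝ → ℝ) : Prop where
  measurable : Measurable (Function.uncurry σ)
  mem_Icc : ∀ v p, σ v p ∈ Icc (0 : ℝ) 1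
  buy_one : ∀ v p, v.2 - p.2 < v.1 - p.1 → σ v p = 1
  buy_two : ∀ v p, v.1 - p.1 < v.2 - p.2 → σ v p = 0

/-- A (mixed) pricing strategy: a distribution of prices with finite mean. -/
structure IsPricing (G : Measure ℝ) : Prop where
  prob : IsProbabilityMeasure G
  finiteMean : Integrable (fun p => p) G

/-- The consumer's reduced form utility `u(x, y)`, gross of the cost of information, when the firms
draw prices independently from `G₁` and `G₂`. -/
def grossUtility (σ : ℝ × ℝ → ℝ × ℝ → ℝ) (G₁ G₂ : Measure ℝ) (v : ℝ × ℝ) : ℝ :=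
  ∫ p, (σ v p * (v.1 - p.1) + (1 - σ v p) * (v.2 - p.2)) ∂(G₁.prod G₂)

/-- The consumer's expected payoff `∫ (u - κ c) dF` from acquiring `F`. -/
def consumerPayoff (φ : ℝ → ℝ) (κ : ℝ) (σ : ℝ × ℝ → ℝ × ℝ → ℝ) (G₁ G₂ : Measure ℝ)
    (F : Measure (ℝ × ℝ)) : ℝ :=
  ∫ v, (grossUtility σ G₁ G₂ v - κ * cost φ v) ∂F

/-- Expected profit of firm 1 from the strategy `G₁`, given the distribution `F` of posterior means
and firm 2's strategy `G₂` (marginal costs are zero). -/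
def profit₁ (σ : ℝ × ℝ → ℝ × ℝ → ℝ) (F : Measure (ℝ × ℝ)) (G₁ G₂ : Measure ℝ) : ℝ :=
  ∫ p₁, p₁ * (∫ v, ∫ p₂, σ v (p₁, p₂) ∂G₂ ∂F) ∂G₁

/-- Expected profit of firm 2. -/
def profit₂ (σ : ℝ × ℝ → ℝ × ℝ → ℝ) (F : Measure (ℝ × ℝ)) (G₁ G₂ : Measure ℝ) : ℝ :=
  ∫ p₂, p₂ * (∫ v, ∫ p₁, (1 - σ v (p₁, p₂)) ∂G₁ ∂F) ∂G₂

/-- Equilibrium of the game with prior `H`: the consumer privately acquires the fusion `F` of `H`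
at cost `κ ∫ c dF`, the firms, not observing this, simultaneously price according to `G₁` and `G₂`,
and the consumer then buys according to `σ`. Nobody has a profitable deviation. Fusions against
which the (nonnegative) cost integrand is not integrable are infinitely costly, so only those of
finite cost are compared. -/
structure IsEquilibrium (φ : ℝ → ℝ) (κ : ℝ) (H F : Measure (ℝ × ℝ)) (G₁ G₂ : Measure ℝ)
    (σ : ℝ × ℝ → ℝ × ℝ → ℝ) : Prop where
  purchase : IsPurchaseRule σ
  pricing₁ : IsPricing G₁
  pricing₂ : IsPricing G₂
  fusion : IsFusion H F
  finiteCost : Integrable (cost φ) F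
  learning_optimal : ∀ F' : Measure (ℝ × ℝ), IsFusion H F' → Integrable (cost φ) F' →
    consumerPayoff φ κ σ G₁ G₂ F' ≤ consumerPayoff φ κ σ G₁ G₂ F
  price_optimal₁ : ∀ G : Measure ℝ, IsPricing G → profit₁ σ F G G₂ ≤ profit₁ σ F G₁ G₂
  price_optimal₂ : ∀ G : Measure ℝ, IsPricing G → profit₂ σ F G₁ G ≤ profit₂ σ F G₁ G₂

/-! ### The equilibrium strategies -/

/-- Comparison shopping with uniform two-point support: the points `((1-l)/2, (1+l)/2)` and
`((1+l)/2, (1-l)/2)`, each with probability `1/2`. -/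
def twoPoint (l : ℝ) : Measure (ℝ × ℝ) :=
  (2⁻¹ : ENNReal) • Measure.dirac ((1 - l) / 2, (1 + l) / 2) +
    (2⁻¹ : ENNReal) • Measure.dirac ((1 + l) / 2, (1 - l) / 2)

/-- The distribution function `Γ` of prices, for the parameter `l > 0`. -/
def Gam (l p : ℝ) : ℝ :=
  if p < √2 * l then 0
  else if p ≤ (1 + √2) * l then (p - √2 * l) / (l + p)
  else if p ≤ (2 + √2) * l then ((3 + √2) * l - 2 * p) / (l - p)
  else 1

end CompShop

end

/-! Firms. Against the two-point distribution the difference of posterior means is `l` or `-l` with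
equal odds, so a price `p` earns `p * ((1 - Γ(p + l)) + (1 - Γ(p - l))) / 2`. The two branches of
`Gam` are what makes this equal to `(1 + √2) * l / 2` throughout the support; elsewhere it is no
larger (`revenue_le`). The price law has no atoms, so ties have probability zero.

Consumer. Swapping the two identically distributed prices turns the gross utility at `(x, y)` into
`(x + y) / 2`, minus the mean price, plus half the expectation of `max |x - y| |D|`, where `D` is
the price gap (`grossUtility_eq`). Every fusion has the prior's mean, so the linear part is a
constant and it remains to bound a function of `t = |x - y|` minus the cost pointwise. Convexity and
symmetry push the cheapest way of reaching a given `t` onto the antidiagonal (`cost_ge`). There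
benefit and cost are separated by a parabola in `t` touching both at `t = l`: - the cost lies above
it, since the marginal cost of spreading is convex in `t` and vanishes at zero
(`marginalCost_spread_ge`); - the benefit lies below it (`gapPotential_le`), since its slope in `t /
l` is the mass of the gap density on `[0, t / l]`, and that density decreases on `[0, 1]` and stays
below its value at `1` afterwards. The first order condition `κ * spreadSlope φ l = gapMass` makes
the two parabolas one.

The delicate point is that the gap density decreases on `[0, 1]` although the price density jumps
upwards in the middle of its support (`gapDensity_le_of_near`): the decline in the autocorrelations
of the two decreasing pieces must outweigh the growth of their cross-correlation.

Feasibility. A density bounded below by `d > 0` admits a binary signal inducing the two points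
whenever `6 * l ≤ d` (`isFusion_twoPoint`). The first order condition has a root `l` below any given
level once `κ` is large (`exists_spread`), which yields the threshold. -/

noncomputable section

namespace CompShop

/-! ### The density of the price gap -/

/-- Put `d = s' - s` and shift the second integral by `d`, so that both carry the factor `g (u +
s)`. Their difference is the integral of `g u * g (u + s)` over `[0, d]` minus that of `(g (u - d) -
g u) * g (u + s)` over `[d, 1 - s]`. The common factor is at least `g s'` on the first interval and
at most `g s'` on the second, so replacing it by `g s'` gives a lower bound, and what is left
telescopes. -/
theorem autocorr_drop {g : ℝ → ℝ} (hc : ContinuousOn g (Icc 0 1)) (ha : AntitoneOn g (Icc 0 1))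
    (hn : ∀ x ∈ Icc (0 : ℝ) 1, 0 ≤ g x) {s s' : ℝ} (hs : 0 ≤ s) (hss : s ≤ s') (hs' : s' ≤ 1) :
    g s' * ∫ x in (1 - s')..(1 - s), g x ≤
      (∫ u in (0)..(1 - s), g u * g (u + s)) - ∫ u in (0)..(1 - s'), g u * g (u + s') := by
  have int1 : ∀ a b : ℝ, 0 ≤ a → a ≤ b → b ≤ 1 → IntervalIntegrable g volume a b := by
    intro a b h0 h1 h2
    refine (hc.mono ?_).intervalIntegrable
    rw [uIcc_of_le h1]; exact Icc_subset_Icc h0 h2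
  have cprod : ∀ a b c d : ℝ, 0 ≤ a + c → b + c ≤ 1 → 0 ≤ a + d → b + d ≤ 1 → a ≤ b →
      IntervalIntegrable (fun u => g (u + c) * g (u + d)) volume a b := by
    intro a b c d h1 h2 h3 h4 h5
    refine ContinuousOn.intervalIntegrable ?_
    rw [uIcc_of_le h5]
    refine ContinuousOn.mul (hc.comp (by fun_prop) ?_) (hc.comp (by fun_prop) ?_) <;>
      intro x hx <;> constructor <;> linarith [hx.1, hx.2]
  have csh : ∀ a b c : ℝ, 0 ≤ a + c → b + c ≤ 1 → a ≤ b →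
      IntervalIntegrable (fun u => g (u + c)) volume a b := by
    intro a b c h1 h2 h5
    refine ContinuousOn.intervalIntegrable ?_
    rw [uIcc_of_le h5]
    refine (hc.comp (by fun_prop) ?_)
    intro x hx; constructor <;> linarith [hx.1, hx.2]
  set d := s' - s with hd
  have hd0 : 0 ≤ d := by linarith
  have e2 : ∫ u in (0)..(1 - s'), g u * g (u + s') = ∫ u in d..(1 - s), g (u + -d) * g (u + s) := by
    have := intervalIntegral.integral_comp_add_right (a := 0) (b := 1 - s')
      (fun u => g (u + -d) * g (u + s)) d
    rw [show 0 + d = d by ring, show 1 - s' + d = 1 - s by rw [hd]; ring] at this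
    rw [← this]
    congr 1; ext u
    rw [show u + d + -d = u by ring, show u + d + s = u + s' by rw [hd]; ring]
  have e1 : ∫ u in (0)..(1 - s), g u * g (u + s) =
      (∫ u in (0)..d, g u * g (u + s)) + ∫ u in d..(1 - s), g u * g (u + s) := by
    rw [intervalIntegral.integral_add_adjacent_intervals]
    · simpa using cprod 0 d 0 s (by linarith) (by linarith) (by linarith) (by linarith) hd0
    · simpa using cprod d (1 - s) 0 s (by linarith) (by linarith) (by linarith) (by linarith)
        (by linarith)
  have i1 : g s' * ∫ u in (0)..d, g u ≤ ∫ u in (0)..d, g u * g (u + s) := by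
    rw [← intervalIntegral.integral_const_mul]
    refine intervalIntegral.integral_mono_on hd0 ((int1 0 d le_rfl hd0 (by linarith)).const_mul _)
      (by simpa using cprod 0 d 0 s (by linarith) (by linarith) (by linarith) (by linarith) hd0) ?_
    intro u hu
    rw [mul_comm]
    exact mul_le_mul_of_nonneg_left (ha ⟨by linarith [hu.1], by linarith [hu.2]⟩
      ⟨by linarith, hs'⟩ (by linarith [hu.2])) (hn u ⟨hu.1, by linarith [hu.2]⟩)
  have i2 : ∫ u in d..(1 - s), (g (u + -d) - g u) * g (u + s) ≤
      g s' * ∫ u in d..(1 - s), (g (u + -d) - g u) := by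
    rw [← intervalIntegral.integral_const_mul]
    refine intervalIntegral.integral_mono_on (by linarith) ?_ ?_ ?_
    · simp only [sub_mul]
      refine (cprod _ _ _ _ ?_ ?_ ?_ ?_ ?_).sub ?_ <;> try linarith
      simpa using cprod d (1 - s) 0 s (by linarith) (by linarith) (by linarith) (by linarith)
        (by linarith)
    · refine ((csh _ _ _ ?_ ?_ ?_).sub (int1 _ _ ?_ ?_ ?_)).const_mul _ <;> linarith
    · intro u hu
      rw [mul_comm]
      refine mul_le_mul_of_nonneg_right (ha ⟨by linarith [hu.1], by linarith [hu.2]⟩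
        ⟨by linarith [hu.1], by linarith [hu.2]⟩ (by linarith [hu.1])) ?_
      exact sub_nonneg.2 (ha ⟨by linarith [hu.1], by linarith [hu.2]⟩
        ⟨by linarith [hu.1], by linarith [hu.2]⟩ (by linarith))
  have e3 : ∫ u in d..(1 - s), (g (u + -d) - g u) * g (u + s) =
      (∫ u in d..(1 - s), g (u + -d) * g (u + s)) - ∫ u in d..(1 - s), g u * g (u + s) := by
    simp only [sub_mul]
    refine intervalIntegral.integral_sub (cprod _ _ _ _ ?_ ?_ ?_ ?_ ?_) ?_ <;> try linarith
    simpa using cprod d (1 - s) 0 s (by linarith) (by linarith) (by linarith) (by linarith)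
        (by linarith)
  have e4 : ∫ u in d..(1 - s), (g (u + -d) - g u) =
      (∫ u in (0)..(1 - s'), g u) - ∫ u in d..(1 - s), g u := by
    rw [intervalIntegral.integral_sub (csh _ _ _ (by linarith) (by linarith) (by linarith))
      (int1 _ _ hd0 (by linarith) (by linarith)), intervalIntegral.integral_comp_add_right]
    congr 2 <;> rw [hd] <;> ring
  have e5 := intervalIntegral.integral_add_adjacent_intervals
    (int1 0 d le_rfl hd0 (by linarith)) (int1 d (1 - s) hd0 (by linarith) (by linarith))
  have e6 := intervalIntegral.integral_add_adjacent_intervals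
    (int1 0 (1 - s') le_rfl (by linarith) (by linarith))
    (int1 (1 - s') (1 - s) (by linarith) (by linarith) (by linarith))
  have e7 : ∫ x in (1 - s')..(1 - s), g x = (∫ u in (0)..d, g u) -
      ∫ u in d..(1 - s), (g (u + -d) - g u) := by rw [e4]; linarith
  rw [e7, mul_sub, e1, e2]
  linarith

/-! ### The two pieces of the normalized price density -/

def lowDensity (x : ℝ) : ℝ := (1 + √2) / (1 + √2 + x) ^ 2

def highDensity (x : ℝ) : ℝ := (1 + √2) / (√2 + x) ^ 2

theorem sqrt_two_bounds : 1.414 < √2 ∧ √2 < 1.415 ∧ √2 * √2 = 2 := by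
  refine ⟨Real.lt_sqrt_of_sq_lt (by norm_num), ?_, Real.mul_self_sqrt (by norm_num)⟩
  rw [Real.sqrt_lt' (by norm_num)]; norm_num

theorem lowDensity_continuousOn : ContinuousOn lowDensity (Icc 0 1) := by
  unfold lowDensity
  refine ContinuousOn.div (by fun_prop) (by fun_prop) ?_
  intro x hx
  have := sqrt_two_bounds.1
  have := hx.1
  positivity

theorem highDensity_continuousOn : ContinuousOn highDensity (Icc 0 1) := by
  unfold highDensity
  refine ContinuousOn.div (by fun_prop) (by fun_prop) ?_
  intro x hx
  have := sqrt_two_bounds.1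
  have := hx.1
  positivity

theorem lowDensity_antitoneOn : AntitoneOn lowDensity (Icc 0 1) := by
  intro x hx y hy hxy
  have := hx.1
  unfold lowDensity
  gcongr

theorem highDensity_antitoneOn : AntitoneOn highDensity (Icc 0 1) := by
  intro x hx y hy hxy
  have := hx.1
  unfold highDensity
  gcongr

theorem lowDensity_nonneg (x : ℝ) : 0 ≤ lowDensity x := by
  unfold lowDensity; positivity

theorem highDensity_nonneg (x : ℝ) : 0 ≤ highDensity x := by
  unfold highDensity; positivity

/-- The pointwise comparison behind the monotonicity of the density of the price gap. -/
theorem density_compare {s x : ℝ} (hs0 : 0 ≤ s) (hs : s ≤ 1) (hx0 : 0 ≤ x)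
    (hx : x ≤ 1 - s + 1 / 4) :
    highDensity 0 * lowDensity x ≤ highDensity s * highDensity x + lowDensity s * lowDensity x := by
  obtain ⟨h1, h2, h3⟩ := sqrt_two_bounds
  set r := √2
  have k1 : lowDensity 1 * lowDensity x ≤ lowDensity s * lowDensity x :=
    mul_le_mul_of_nonneg_right (lowDensity_antitoneOn ⟨hs0, hs⟩ ⟨zero_le_one, le_rfl⟩ hs)
      (lowDensity_nonneg x)
  -- The price density jumps up by exactly `1` between its two pieces, so it suffices to absorb one
  -- copy of `lowDensity x` into the product of high densities.
  have k2 : highDensity 0 - lowDensity 1 = 1 := by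
    unfold highDensity lowDensity
    change (1 + r) / (r + 0) ^ 2 - (1 + r) / (1 + r + 1) ^ 2 = 1
    have : r ≠ 0 := by positivity
    have : 1 + r + 1 ≠ 0 := by positivity
    field_simp
    nlinarith
  have k3 : lowDensity x ≤ highDensity s * highDensity x := by
    unfold highDensity lowDensity
    change (1 + r) / (1 + r + x) ^ 2 ≤ (1 + r) / (r + s) ^ 2 * ((1 + r) / (r + x) ^ 2)
    have p1 : 0 < r + s := by positivity
    have p2 : 0 < r + x := by positivity
    rw [div_mul_div_comm, div_le_div_iff₀ (by positivity) (by positivity)]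
    -- The constant `1.553` is chosen with square just below `1 + √2`.
    have : (r + s) * (r + x) ≤ 1.553 * (1 + r + x) := by
      nlinarith
    have h5 : ((r + s) * (r + x)) ^ 2 ≤ (1.553 * (1 + r + x)) ^ 2 := by gcongr
    have : ((r + s) * (r + x)) ^ 2 ≤ (1 + r) * (1 + r + x) ^ 2 := by
      nlinarith [sq_nonneg (1 + r + x)]
    nlinarith
  rw [show highDensity 0 = 1 + lowDensity 1 by linarith, add_mul, one_mul]
  linarith

/-- The density of `p / l - √2` for a price `p` drawn from the equilibrium distribution. -/
def priceDensity (x : ℝ) : ℝ :=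
  if x ≤ 0 then 0 else if x ≤ 1 then lowDensity x else if x ≤ 2 then highDensity (x - 1) else 0

theorem priceDensity_of_nonpos {x : ℝ} (h : x ≤ 0) : priceDensity x = 0 := by
  simp [priceDensity, h]

theorem priceDensity_of_low {x : ℝ} (h : 0 < x) (h' : x ≤ 1) : priceDensity x = lowDensity x := by
  simp [priceDensity, h.not_ge, h']

theorem priceDensity_of_high {x : ℝ} (h : 1 < x) (h' : x ≤ 2) :
    priceDensity x = highDensity (x - 1) := by
  simp [priceDensity, h.not_ge, h', (zero_lt_one.trans h).not_ge]

theorem priceDensity_of_gt {x : ℝ} (h : 2 < x) : priceDensity x = 0 := by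
  simp [priceDensity, h.not_ge, (zero_lt_two.trans h).not_ge, (one_lt_two.trans h).not_ge]

theorem priceDensity_nonneg (x : ℝ) : 0 ≤ priceDensity x := by
  unfold priceDensity
  split_ifs <;> first | exact le_rfl | exact lowDensity_nonneg _ | exact highDensity_nonneg _

theorem lowDensity_le_two {x : ℝ} (h : 0 ≤ x) : lowDensity x ≤ 2 := by
  obtain ⟨h1, h2, h3⟩ := sqrt_two_bounds
  unfold lowDensity
  rw [div_le_iff₀ (by positivity)]
  nlinarith

theorem highDensity_le_two {x : ℝ} (h : 0 ≤ x) : highDensity x ≤ 2 := by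
  obtain ⟨h1, h2, h3⟩ := sqrt_two_bounds
  unfold highDensity
  rw [div_le_iff₀ (by positivity)]
  nlinarith

theorem priceDensity_le_two (x : ℝ) : priceDensity x ≤ 2 := by
  rcases le_or_gt x 0 with h | h
  · simp [priceDensity_of_nonpos h]
  rcases le_or_gt x 1 with h1 | h1
  · rw [priceDensity_of_low h h1]; exact lowDensity_le_two h.le
  rcases le_or_gt x 2 with h2 | h2
  · rw [priceDensity_of_high h1 h2]; exact highDensity_le_two (by linarith)
  · simp [priceDensity_of_gt h2]

theorem measurable_priceDensity : Measurable priceDensity := by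
  unfold priceDensity lowDensity highDensity
  refine Measurable.ite measurableSet_Iic measurable_const (Measurable.ite measurableSet_Iic
    (by fun_prop) (Measurable.ite measurableSet_Iic (by fun_prop) measurable_const))

/-- The density of the difference of two independent draws from `priceDensity`. -/
def gapDensity (s : ℝ) : ℝ := ∫ x, priceDensity x * priceDensity (x + s)

theorem gapDensity_nonneg (s : ℝ) : 0 ≤ gapDensity s :=
  integral_nonneg fun _ => mul_nonneg (priceDensity_nonneg _) (priceDensity_nonneg _)

theorem gapDensity_neg (s : ℝ) : gapDensity (-s) = gapDensity s := by
  unfold gapDensity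
  rw [← integral_add_right_eq_self _ s]
  congr 1; ext x
  rw [add_neg_cancel_right, mul_comm]

theorem gapDensity_eq_setIntegral (s : ℝ) :
    gapDensity s = ∫ x in Ioc 0 (2 - s), priceDensity x * priceDensity (x + s) := by
  refine (setIntegral_eq_integral_of_forall_compl_eq_zero fun x hx => ?_).symm
  rcases le_or_gt x 0 with h | h
  · simp [priceDensity_of_nonpos h]
  · have : 2 < x + s := by
      by_contra h'
      exact hx ⟨h, by linarith⟩
    simp [priceDensity_of_gt this]

theorem gapDensity_of_two_le {s : ℝ} (hs : 2 ≤ s) : gapDensity s = 0 := by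
  rw [gapDensity_eq_setIntegral, Ioc_eq_empty (by linarith)]
  simp

theorem intervalIntegrable_priceDensity_mul (s a b : ℝ) :
    IntervalIntegrable (fun x => priceDensity x * priceDensity (x + s)) volume a b := by
  have hm : Measurable fun x => priceDensity x * priceDensity (x + s) :=
    measurable_priceDensity.mul (measurable_priceDensity.comp (measurable_add_const s))
  rw [intervalIntegrable_iff]
  refine Measure.integrableOn_of_bounded (M := 4) (by simp [uIoc])
    hm.aestronglyMeasurable (Eventually.of_forall fun x => ?_)
  rw [Real.norm_of_nonneg (mul_nonneg (priceDensity_nonneg _) (priceDensity_nonneg _))]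
  have := mul_le_mul (priceDensity_le_two x) (priceDensity_le_two (x + s))
    (priceDensity_nonneg _) zero_le_two
  linarith

/-- The three terms collect the pairs of prices at distance `s` with both in the lower piece, one in
each, and both in the upper piece. At distance at least `1` only the mixed pairs survive. -/
theorem gapDensity_of_le_one {s : ℝ} (hs : 0 ≤ s) (hs1 : s ≤ 1) :
    gapDensity s = (∫ x in (0)..(1 - s), lowDensity x * lowDensity (x + s)) +
      (∫ x in (1 - s)..1, lowDensity x * highDensity (x + s - 1)) +
      ∫ x in (0)..(1 - s), highDensity x * highDensity (x + s) := by
  rw [gapDensity_eq_setIntegral, ← intervalIntegral.integral_of_le (by linarith),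
    ← intervalIntegral.integral_add_adjacent_intervals (b := 1)
      (intervalIntegrable_priceDensity_mul _ _ _) (intervalIntegrable_priceDensity_mul _ _ _),
    ← intervalIntegral.integral_add_adjacent_intervals (a := 0) (b := 1 - s) (c := 1)
      (intervalIntegrable_priceDensity_mul _ _ _) (intervalIntegrable_priceDensity_mul _ _ _)]
  congr 1
  · congr 1
    · refine intervalIntegral.integral_congr_ae (Eventually.of_forall fun x hx => ?_)
      rw [uIoc_of_le (by linarith)] at hx
      rw [priceDensity_of_low hx.1 (by linarith [hx.2]),
        priceDensity_of_low (by linarith [hx.1]) (by linarith [hx.2])]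
    · refine intervalIntegral.integral_congr_ae (Eventually.of_forall fun x hx => ?_)
      rw [uIoc_of_le (by linarith)] at hx
      rw [priceDensity_of_low (by linarith [hx.1]) (by linarith [hx.2]),
        priceDensity_of_high (by linarith [hx.1]) (by linarith [hx.2])]
  · have := intervalIntegral.integral_comp_add_right (a := 0) (b := 1 - s)
      (fun x => priceDensity x * priceDensity (x + s)) 1
    rw [show 1 - s + 1 = 2 - s by ring, zero_add] at this
    rw [← this]
    refine intervalIntegral.integral_congr_ae (Eventually.of_forall fun x hx => ?_)
    rw [uIoc_of_le (by linarith)] at hx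
    rw [priceDensity_of_high (by linarith [hx.1]) (by linarith [hx.2]),
        priceDensity_of_high (by linarith [hx.1]) (by linarith [hx.2])]
    congr 2 <;> ring

theorem gapDensity_of_one_le {s : ℝ} (hs : 1 ≤ s) (hs2 : s ≤ 2) :
    gapDensity s = ∫ x in (0)..(2 - s), lowDensity x * highDensity (x + s - 1) := by
  rw [gapDensity_eq_setIntegral, ← intervalIntegral.integral_of_le (by linarith)]
  refine intervalIntegral.integral_congr_ae (Eventually.of_forall fun x hx => ?_)
  rw [uIoc_of_le (by linarith)] at hx
  rw [priceDensity_of_low (by linarith [hx.1]) (by linarith [hx.2]),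
    priceDensity_of_high (by linarith [hx.1]) (by linarith [hx.2])]

theorem intervalIntegrable_low_mul_high {a b c : ℝ} (ha : 0 ≤ a) (hab : a ≤ b) (hb : b ≤ 1)
    (hc : 0 ≤ a + c - 1) (hc' : b + c - 1 ≤ 1) :
    IntervalIntegrable (fun x => lowDensity x * highDensity (x + c - 1)) volume a b := by
  refine ContinuousOn.intervalIntegrable ?_
  rw [uIcc_of_le hab]
  refine (lowDensity_continuousOn.mono (Icc_subset_Icc ha hb)).mul
    (highDensity_continuousOn.comp (by fun_prop) ?_)
  intro x hx; constructor <;> linarith [hx.1, hx.2]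

/-- Beyond `1` only the cross-correlation is left: raising `s` shortens its range of integration and
moves `highDensity` to the right, where it is smaller. -/
theorem gapDensity_le_one {s : ℝ} (hs : 1 ≤ s) : gapDensity s ≤ gapDensity 1 := by
  rcases le_or_gt s 2 with h | h
  · rw [gapDensity_of_one_le hs h, gapDensity_of_one_le le_rfl one_le_two]
    have i1 := intervalIntegrable_low_mul_high (a := 0) (b := 2 - s) (c := 1) le_rfl (by linarith)
      (by linarith) (by linarith) (by linarith)
    have i2 := intervalIntegrable_low_mul_high (a := 2 - s) (b := 2 - 1) (c := 1) (by linarith)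
      (by linarith) (by linarith) (by linarith) (by linarith)
    rw [← intervalIntegral.integral_add_adjacent_intervals i1 i2]
    have n : 0 ≤ ∫ x in (2 - s)..(2 - 1), lowDensity x * highDensity (x + 1 - 1) :=
      intervalIntegral.integral_nonneg (by linarith) fun x _ =>
        mul_nonneg (lowDensity_nonneg _) (highDensity_nonneg _)
    have : ∫ x in (0)..(2 - s), lowDensity x * highDensity (x + s - 1) ≤
        ∫ x in (0)..(2 - s), lowDensity x * highDensity (x + 1 - 1) := by
      refine intervalIntegral.integral_mono_on (by linarith)
        (intervalIntegrable_low_mul_high le_rfl (by linarith) (by linarith) (by linarith)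
          (by linarith)) i1 fun x hx => ?_
      refine mul_le_mul_of_nonneg_left (highDensity_antitoneOn ?_ ?_ (by linarith))
        (lowDensity_nonneg _) <;> constructor <;> linarith [hx.1, hx.2]
    linarith
  · rw [gapDensity_of_two_le h.le]
    exact gapDensity_nonneg 1

/-- As `s` grows to `s'`, the cross-correlation gains at most `highDensity 0` times the integral of
`lowDensity` over the newly reached interval `[1 - s', 1 - s]`. The two autocorrelations lose at
least the amounts in `autocorr_drop`, integrals over that same interval, and `density_compare`
orders the integrands pointwise. Its slack of `1 / 4` in `x` is what limits the step `s' - s`. -/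
theorem gapDensity_le_of_near {s s' : ℝ} (hs : 0 ≤ s) (hss : s ≤ s') (hs' : s' ≤ 1)
    (hn : s' ≤ s + 1 / 4) : gapDensity s' ≤ gapDensity s := by
  rw [gapDensity_of_le_one hs (hss.trans hs'), gapDensity_of_le_one (hs.trans hss) hs']
  have d1 := autocorr_drop lowDensity_continuousOn lowDensity_antitoneOn
    (fun x _ => lowDensity_nonneg x) hs hss hs'
  have d2 := autocorr_drop highDensity_continuousOn highDensity_antitoneOn
    (fun x _ => highDensity_nonneg x) hs hss hs'
  have i0 := intervalIntegrable_low_mul_high (a := 1 - s') (b := 1 - s) (c := s') (by linarith)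
    (by linarith) (by linarith) (by linarith) (by linarith)
  have i1 := intervalIntegrable_low_mul_high (a := 1 - s) (b := 1) (c := s') (by linarith)
    (by linarith) (by linarith) (by linarith) (by linarith)
  have i2 := intervalIntegrable_low_mul_high (a := 1 - s) (b := 1) (c := s) (by linarith)
    (by linarith) (by linarith) (by linarith) (by linarith)
  have iL : IntervalIntegrable lowDensity volume (1 - s') (1 - s) := by
    refine (lowDensity_continuousOn.mono ?_).intervalIntegrable
    rw [uIcc_of_le (by linarith)]; exact Icc_subset_Icc (by linarith) (by linarith)
  have iH : IntervalIntegrable highDensity volume (1 - s') (1 - s) := by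
    refine (highDensity_continuousOn.mono ?_).intervalIntegrable
    rw [uIcc_of_le (by linarith)]; exact Icc_subset_Icc (by linarith) (by linarith)
  have m1 : ∫ x in (1 - s)..1, lowDensity x * highDensity (x + s' - 1) ≤
      ∫ x in (1 - s)..1, lowDensity x * highDensity (x + s - 1) := by
    refine intervalIntegral.integral_mono_on (by linarith) i1 i2 fun x hx => ?_
    refine mul_le_mul_of_nonneg_left (highDensity_antitoneOn ?_ ?_ (by linarith))
        (lowDensity_nonneg _) <;> constructor <;> linarith [hx.1, hx.2]
  have m2 : ∫ x in (1 - s')..(1 - s), lowDensity x * highDensity (x + s' - 1) ≤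
      ∫ x in (1 - s')..(1 - s), highDensity 0 * lowDensity x := by
    refine intervalIntegral.integral_mono_on (by linarith) i0 (iL.const_mul _) fun x hx => ?_
    rw [mul_comm]
    refine mul_le_mul_of_nonneg_right (highDensity_antitoneOn ?_ ?_ (by linarith [hx.1]))
        (lowDensity_nonneg _) <;> constructor <;> linarith [hx.1, hx.2]
  have m3 : ∫ x in (1 - s')..(1 - s), highDensity 0 * lowDensity x ≤
      ∫ x in (1 - s')..(1 - s),
        (highDensity s' * highDensity x + lowDensity s' * lowDensity x) := by
    refine intervalIntegral.integral_mono_on (by linarith) (iL.const_mul _)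
      ((iH.const_mul _).add (iL.const_mul _)) fun x hx => ?_
    exact density_compare (by linarith) hs' (by linarith [hx.1]) (by linarith [hx.2])
  rw [intervalIntegral.integral_add (iH.const_mul _) (iL.const_mul _),
    intervalIntegral.integral_const_mul, intervalIntegral.integral_const_mul,
    intervalIntegral.integral_const_mul] at m3
  rw [intervalIntegral.integral_const_mul] at m2
  rw [← intervalIntegral.integral_add_adjacent_intervals i0 i1]
  linarith

theorem gapDensity_antitoneOn : AntitoneOn gapDensity (Icc 0 1) := by
  intro s hs s' hs' hss
  obtain ⟨h0, -⟩ := hs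
  obtain ⟨-, h1⟩ := hs'
  -- Four steps, each of length at most `1 / 4`, cover any pair in `[0, 1]`.
  set d := (s' - s) / 4 with hd
  have k1 := gapDensity_le_of_near (s := s) (s' := s + d) h0
    (by linarith) (by linarith) (by linarith)
  have k2 := gapDensity_le_of_near (s := s + d) (s' := s + 2 * d) (by linarith)
    (by linarith) (by linarith) (by linarith)
  have k3 := gapDensity_le_of_near (s := s + 2 * d) (s' := s + 3 * d) (by linarith)
    (by linarith) (by linarith) (by linarith)
  have k4 := gapDensity_le_of_near (s := s + 3 * d) (s' := s') (by linarith)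
    (by linarith) (by linarith) (by linarith)
  linarith

/-! ### The reduced form of the expected price gap -/

theorem measurable_gapDensity : Measurable gapDensity := by
  have h : StronglyMeasurable (Function.uncurry fun s x : ℝ =>
      priceDensity x * priceDensity (x + s)) := by
    refine Measurable.stronglyMeasurable ?_
    exact (measurable_priceDensity.comp measurable_snd).mul
      (measurable_priceDensity.comp (measurable_snd.add measurable_fst))
  exact h.integral_prod_right.measurable

theorem gapDensity_le_zero {s : ℝ} (hs : 0 ≤ s) : gapDensity s ≤ gapDensity 0 := by
  rcases le_or_gt s 1 with h | h
  · exact gapDensity_antitoneOn ⟨le_rfl, zero_le_one⟩ ⟨hs, h⟩ hs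
  · exact (gapDensity_le_one h.le).trans
      (gapDensity_antitoneOn ⟨le_rfl, zero_le_one⟩ ⟨zero_le_one, le_rfl⟩ zero_le_one)

theorem intervalIntegrable_gapDensity_mul {k : ℝ → ℝ} (hk : Continuous k) {a b : ℝ} (ha : 0 ≤ a)
    (hab : a ≤ b) : IntervalIntegrable (fun s => gapDensity s * k s) volume a b := by
  refine IntervalIntegrable.mul_continuousOn ?_ hk.continuousOn
  rw [intervalIntegrable_iff, uIoc_of_le hab]
  refine Measure.integrableOn_of_bounded (M := gapDensity 0) (by simp)
    measurable_gapDensity.aestronglyMeasurable ?_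
  filter_upwards [ae_restrict_mem measurableSet_Ioc] with s hs
  rw [Real.norm_of_nonneg (gapDensity_nonneg s)]
  exact gapDensity_le_zero (ha.trans hs.1.le)

theorem intervalIntegrable_gapDensity {a b : ℝ} (ha : 0 ≤ a) (hab : a ≤ b) :
    IntervalIntegrable gapDensity volume a b := by
  simpa using intervalIntegrable_gapDensity_mul (k := fun _ => 1) continuous_const ha hab

/-- The probability that the price gap lies between `0` and `1` (in units of `l`). -/
def gapMass : ℝ := ∫ s in (0)..1, gapDensity s

theorem gapDensity_one_le_gapMass : gapDensity 1 ≤ gapMass := by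
  have : ∫ s in (0 : ℝ)..1, gapDensity 1 ≤ gapMass :=
    intervalIntegral.integral_mono_on zero_le_one intervalIntegrable_const
      (intervalIntegrable_gapDensity le_rfl zero_le_one) fun s hs =>
        gapDensity_antitoneOn hs ⟨zero_le_one, le_rfl⟩ hs.2
  simpa using this

theorem gapDensity_one_pos : 0 < gapDensity 1 := by
  rw [gapDensity_of_one_le le_rfl one_le_two]
  refine intervalIntegral.intervalIntegral_pos_of_pos_on
    (intervalIntegrable_low_mul_high le_rfl (by norm_num) (by norm_num) (by norm_num)
      (by norm_num)) (fun x hx => ?_) (by norm_num)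
  have := hx.1
  unfold lowDensity highDensity
  have : 0 < √2 + (x + 1 - 1) := by rw [add_sub_cancel_right]; positivity
  positivity

theorem gapMass_pos : 0 < gapMass := gapDensity_one_pos.trans_le gapDensity_one_le_gapMass

/-- Half the expectation of `max t |D|`, where `D` is the price gap (in units of `l`). -/
def gapPotential (t : ℝ) : ℝ := ∫ s in Ioi 0, gapDensity s * max t s

theorem gapPotential_eq (t : ℝ) {T : ℝ} (hT : 2 ≤ T) :
    gapPotential t = ∫ s in (0)..T, gapDensity s * max t s := by
  rw [intervalIntegral.integral_of_le (by linarith)]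
  refine setIntegral_eq_of_subset_of_forall_sdiff_eq_zero measurableSet_Ioi Ioc_subset_Ioi_self ?_
  intro s hs
  have : 2 ≤ s := by
    by_contra h
    exact hs.2 ⟨hs.1, by linarith⟩
  simp [gapDensity_of_two_le this]

/-- A Chebyshev type inequality: on `[0, 1]` both `gapDensity` and `1 - max t s` decrease in `s`, so
the integral of their product is at least the product of their integrals. -/
theorem gapPotential_sub_le_of_le_one {t : ℝ} (ht0 : 0 ≤ t) (ht : t ≤ 1) :
    gapMass * ((1 - t ^ 2) / 2) ≤ gapPotential 1 - gapPotential t := by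
  have c1 : Continuous fun s : ℝ => max 1 s := by fun_prop
  have ct : Continuous fun s : ℝ => max t s := by fun_prop
  have cd : Continuous fun s : ℝ => max 1 s - max t s := by fun_prop
  have hi := @intervalIntegrable_gapDensity_mul
  rw [gapPotential_eq 1 le_rfl, gapPotential_eq t le_rfl,
    ← intervalIntegral.integral_sub (hi c1 le_rfl zero_le_two) (hi ct le_rfl zero_le_two)]
  simp only [← mul_sub]
  rw [← intervalIntegral.integral_add_adjacent_intervals (b := 1)
    (hi cd le_rfl zero_le_one) (hi cd zero_le_one one_le_two)]
  have z : ∫ s in (1 : ℝ)..2, gapDensity s * (max 1 s - max t s) = 0 := by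
    rw [intervalIntegral.integral_congr (g := fun _ => 0)]
    · simp
    · intro s hs
      rw [uIcc_of_le one_le_two] at hs
      simp [max_eq_right hs.1, max_eq_right (ht.trans hs.1)]
  rw [z, add_zero]
  -- The mean of `1 - max t s` over `[0, 1]`. This function falls through the level `m` at `s = 1 -
  -- m`, which is at least `t`; subtracting the value of `gapDensity` there makes both factors below
  -- change sign together.
  set m := (1 - t ^ 2) / 2 with hm
  have key : 0 ≤ ∫ s in (0 : ℝ)..1,
      (gapDensity s - gapDensity (1 - m)) * ((max 1 s - max t s) - m) := by
    refine intervalIntegral.integral_nonneg zero_le_one fun s hs => ?_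
    have hm0 : 1 - m ∈ Icc (0 : ℝ) 1 := ⟨by nlinarith, by nlinarith⟩
    rw [max_eq_left hs.2]
    rcases le_total s (1 - m) with h | h
    · refine mul_nonneg (sub_nonneg.2 (gapDensity_antitoneOn hs hm0 h)) ?_
      have : max t s ≤ 1 - m := max_le (by nlinarith) h
      linarith
    · refine mul_nonneg_of_nonpos_of_nonpos (sub_nonpos.2 (gapDensity_antitoneOn hm0 hs h)) ?_
      have := le_max_right t s
      linarith
  have hk : ∫ s in (0 : ℝ)..1, (max 1 s - max t s) = m := by
    rw [← intervalIntegral.integral_add_adjacent_intervals (b := t)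
      (cd.intervalIntegrable _ _) (cd.intervalIntegrable _ _)]
    rw [intervalIntegral.integral_congr (b := t) (g := fun _ => 1 - t),
      intervalIntegral.integral_congr (a := t) (g := fun s => 1 - s)]
    · have e : ∫ s in t..1, (1 - s) = (1 - t) - (1 - t ^ 2) / 2 := by
        rw [intervalIntegral.integral_sub (by simp) (by simp)]
        simp
      rw [e, intervalIntegral.integral_const, smul_eq_mul, hm]
      ring
    · intro s hs
      rw [uIcc_of_le ht] at hs
      simp [max_eq_left hs.2, max_eq_right hs.1]
    · intro s hs
      rw [uIcc_of_le ht0] at hs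
      simp [max_eq_left hs.2, max_eq_left (hs.2.trans ht)]
  have e : ∫ s in (0 : ℝ)..1, (gapDensity s - gapDensity (1 - m)) * ((max 1 s - max t s) - m) =
      (∫ s in (0 : ℝ)..1, gapDensity s * (max 1 s - max t s)) - gapMass * m := by
    have : ∀ s, (gapDensity s - gapDensity (1 - m)) * ((max 1 s - max t s) - m) =
      (gapDensity s * (max 1 s - max t s) - gapDensity s * m) -
        gapDensity (1 - m) * ((max 1 s - max t s) - m) := fun s => by ring
    simp_rw [this]
    have cm : Continuous fun s : ℝ => (max 1 s - max t s) - m := by fun_prop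
    rw [intervalIntegral.integral_sub ((hi cd le_rfl zero_le_one).sub
        (hi continuous_const le_rfl zero_le_one))
        ((cm.intervalIntegrable _ _).const_mul _),
      intervalIntegral.integral_sub (hi cd le_rfl zero_le_one)
        (hi continuous_const le_rfl zero_le_one), intervalIntegral.integral_const_mul,
      intervalIntegral.integral_mul_const,
      intervalIntegral.integral_sub (cd.intervalIntegrable _ _) (by simp), hk]
    simp [gapMass]
  linarith

/-- The part of the gap density on `[0, 1]` contributes exactly `gapMass * (t - 1)`. Beyond `1` the
density is at most its value at `1`, hence at most `gapMass`, which adds at most `gapMass * (t - 1)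
^ 2 / 2`. -/
theorem gapPotential_sub_le_of_one_le {t : ℝ} (ht : 1 ≤ t) :
    gapPotential t - gapPotential 1 ≤ gapMass * ((t ^ 2 - 1) / 2) := by
  have c1 : Continuous fun s : ℝ => max 1 s := by fun_prop
  have ct : Continuous fun s : ℝ => max t s := by fun_prop
  have cd : Continuous fun s : ℝ => max t s - max 1 s := by fun_prop
  have hi := @intervalIntegrable_gapDensity_mul
  -- The cutoff `t + 1` lies beyond both `2`, where the gap density vanishes, and `t`, where the two
  -- maxima agree.
  have hT : 2 ≤ t + 1 := by linarith
  have hT0 : 0 ≤ t + 1 := by linarith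
  rw [gapPotential_eq 1 hT, gapPotential_eq t hT,
    ← intervalIntegral.integral_sub (hi ct le_rfl hT0) (hi c1 le_rfl hT0)]
  simp only [← mul_sub]
  rw [← intervalIntegral.integral_add_adjacent_intervals (b := 1)
    (hi cd le_rfl zero_le_one) (hi cd zero_le_one (by linarith)),
    ← intervalIntegral.integral_add_adjacent_intervals (a := 1) (b := t)
    (hi cd zero_le_one ht) (hi cd (by linarith) (by linarith))]
  have z : ∫ s in t..(t + 1), gapDensity s * (max t s - max 1 s) = 0 := by
    rw [intervalIntegral.integral_congr (g := fun _ => 0)]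
    · simp
    · intro s hs
      rw [uIcc_of_le (by linarith)] at hs
      simp [max_eq_right hs.1, max_eq_right (ht.trans hs.1)]
  have e1 : ∫ s in (0 : ℝ)..1, gapDensity s * (max t s - max 1 s) = gapMass * (t - 1) := by
    rw [gapMass, ← intervalIntegral.integral_mul_const]
    refine intervalIntegral.integral_congr fun s hs => ?_
    rw [uIcc_of_le zero_le_one] at hs
    simp [max_eq_left hs.2, max_eq_left (hs.2.trans ht)]
  have e2 : ∫ s in (1 : ℝ)..t, gapDensity s * (max t s - max 1 s) ≤
      ∫ s in (1 : ℝ)..t, gapMass * (t - s) := by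
    refine intervalIntegral.integral_mono_on ht (hi cd zero_le_one ht)
      (Continuous.intervalIntegrable (by fun_prop) _ _) fun s hs => ?_
    rw [max_eq_left hs.2, max_eq_right hs.1]
    exact mul_le_mul_of_nonneg_right ((gapDensity_le_one hs.1).trans gapDensity_one_le_gapMass)
      (by linarith [hs.2])
  rw [intervalIntegral.integral_const_mul, intervalIntegral.integral_sub (by simp) (by simp)] at e2
  simp at e2
  rw [z, e1]
  nlinarith

theorem gapPotential_le {t : ℝ} (ht : 0 ≤ t) :
    gapPotential t ≤ gapPotential 1 + gapMass / 2 * (t ^ 2 - 1) := by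
  rcases le_total t 1 with h | h
  · linarith [gapPotential_sub_le_of_le_one ht h]
  · linarith [gapPotential_sub_le_of_one_le h]

/-! ### The distribution of prices -/

/-- The equilibrium price in the units `p / l - √2`, in which its law does not depend on `l`. -/
def basePriceLaw : Measure ℝ := volume.withDensity fun x => ENNReal.ofReal (priceDensity x)

theorem integral_lowDensity {x : ℝ} (hx : 0 ≤ x) :
    ∫ u in (0)..x, lowDensity u = x / (1 + √2 + x) := by
  have p : ∀ u ∈ uIcc 0 x, 0 < 1 + √2 + u := by
    intro u hu
    rw [uIcc_of_le hx] at hu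
    have := hu.1
    positivity
  rw [intervalIntegral.integral_eq_sub_of_hasDerivAt (f := fun u => u / (1 + √2 + u))]
  · simp
  · intro u hu
    have := (hasDerivAt_id u).div ((hasDerivAt_id u).const_add (1 + √2)) (p u hu).ne'
    refine this.congr_deriv ?_
    simp [lowDensity]
  · refine ContinuousOn.intervalIntegrable ?_
    unfold lowDensity
    exact ContinuousOn.div (by fun_prop) (by fun_prop) fun u hu => (pow_pos (p u hu) 2).ne'

theorem integral_highDensity {x : ℝ} (hx : 0 ≤ x) :
    ∫ u in (0)..x, highDensity u = (1 + √2) * x / (√2 * (√2 + x)) := by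
  have p : ∀ u ∈ uIcc 0 x, 0 < √2 + u := by
    intro u hu
    rw [uIcc_of_le hx] at hu
    have := hu.1
    positivity
  rw [intervalIntegral.integral_eq_sub_of_hasDerivAt
    (f := fun u => (1 + √2) / √2 * (u / (√2 + u)))]
  · simp
    rw [div_mul_div_comm]
  · intro u hu
    have := ((hasDerivAt_id u).div ((hasDerivAt_id u).const_add √2) (p u hu).ne').const_mul
      ((1 + √2) / √2)
    refine this.congr_deriv ?_
    have := p u hu
    simp [highDensity]
    field_simp
  · refine ContinuousOn.intervalIntegrable ?_
    unfold highDensity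
    exact ContinuousOn.div (by fun_prop) (by fun_prop) fun u hu => (pow_pos (p u hu) 2).ne'

theorem intervalIntegrable_priceDensity (a b : ℝ) :
    IntervalIntegrable priceDensity volume a b := by
  rw [intervalIntegrable_iff]
  refine Measure.integrableOn_of_bounded (M := 2) (by simp [uIoc])
    measurable_priceDensity.aestronglyMeasurable (Eventually.of_forall fun x => ?_)
  rw [Real.norm_of_nonneg (priceDensity_nonneg _)]
  exact priceDensity_le_two x

theorem integral_priceDensity_low {x : ℝ} (hx : 0 ≤ x) (hx1 : x ≤ 1) :
    ∫ u in (0)..x, priceDensity u = x / (1 + √2 + x) := by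
  rw [← integral_lowDensity hx]
  refine intervalIntegral.integral_congr_ae (Eventually.of_forall fun u hu => ?_)
  rw [uIoc_of_le hx] at hu
  rw [priceDensity_of_low hu.1 (hu.2.trans hx1)]

theorem integral_priceDensity_high {x : ℝ} (hx : 1 ≤ x) (hx1 : x ≤ 2) :
    ∫ u in (0)..x, priceDensity u =
      1 / (1 + √2 + 1) + (1 + √2) * (x - 1) / (√2 * (√2 + (x - 1))) := by
  rw [← integral_highDensity (by linarith : 0 ≤ x - 1),
    ← intervalIntegral.integral_add_adjacent_intervals (b := 1)
    (intervalIntegrable_priceDensity _ _) (intervalIntegrable_priceDensity _ _),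
    integral_priceDensity_low zero_le_one le_rfl]
  congr 1
  have := intervalIntegral.integral_comp_add_right (a := 0) (b := x - 1) priceDensity 1
  rw [zero_add, sub_add_cancel] at this
  rw [← this]
  refine intervalIntegral.integral_congr_ae (Eventually.of_forall fun u hu => ?_)
  rw [uIoc_of_le (by linarith)] at hu
  rw [priceDensity_of_high (by linarith [hu.1]) (by linarith [hu.2]), add_sub_cancel_right]

theorem gam_low {l x : ℝ} (hl : 0 < l) (hx : 0 ≤ x) (hx1 : x ≤ 1) :
    Gam l (l * (x + √2)) = x / (1 + √2 + x) := by
  have h1 : ¬ l * (x + √2) < √2 * l := by nlinarith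
  have h2 : l * (x + √2) ≤ (1 + √2) * l := by nlinarith
  rw [Gam, if_neg h1, if_pos h2]
  have : 0 < 1 + √2 + x := by positivity
  have : 0 < 1 + (x + √2) := by positivity
  field_simp
  ring

theorem gam_high {l x : ℝ} (hl : 0 < l) (hx : 1 ≤ x) (hx1 : x ≤ 2) :
    Gam l (l * (x + √2)) =
      1 / (1 + √2 + 1) + (1 + √2) * (x - 1) / (√2 * (√2 + (x - 1))) := by
  have key : ((3 + √2) * l - 2 * (l * (x + √2))) / (l - l * (x + √2)) =
      1 / (1 + √2 + 1) + (1 + √2) * (x - 1) / (√2 * (√2 + (x - 1))) := by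
    obtain ⟨k1, k2, k3⟩ := sqrt_two_bounds
    generalize √2 = r at *
    have p1 : 0 < r + (x - 1) := by linarith
    have p2 : 0 < 1 + r + 1 := by linarith
    have p3 : l - l * (x + r) ≠ 0 := by nlinarith
    have p4 : r ≠ 0 := by positivity
    rw [div_add_div _ _ p2.ne' (by positivity), div_eq_div_iff p3 (by positivity)]
    -- The identity is not formal in `r`: it needs `r ^ 2 = 2`, so the powers of `r` are reduced
    -- after expanding.
    have hr2 : r ^ 2 = 2 := by nlinarith
    have hr3 : r ^ 3 = 2 * r := by rw [pow_succ, hr2]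
    have hr4 : r ^ 4 = 4 := by rw [show r ^ 4 = (r ^ 2) ^ 2 by ring, hr2]; norm_num
    ring_nf
    rw [hr2, hr3, hr4]
    ring
  -- At the kink `x = 1` the definition of `Gam` takes its lower branch, which has the same value.
  rcases hx.eq_or_lt with rfl | h
  · rw [gam_low hl zero_le_one le_rfl]; simp
  have h1 : ¬ l * (x + √2) < √2 * l := by nlinarith
  have h2 : ¬ l * (x + √2) ≤ (1 + √2) * l := by nlinarith
  have h3 : l * (x + √2) ≤ (2 + √2) * l := by nlinarith
  rw [Gam, if_neg h1, if_neg h2, if_pos h3, key]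

theorem gam_of_neg {l x : ℝ} (hl : 0 < l) (hx : x < 0) : Gam l (l * (x + √2)) = 0 := by
  rw [Gam, if_pos (by nlinarith)]

theorem gam_of_gt {l x : ℝ} (hl : 0 < l) (hx : 2 < x) : Gam l (l * (x + √2)) = 1 := by
  have h1 : ¬ l * (x + √2) < √2 * l := by nlinarith
  have h2 : ¬ l * (x + √2) ≤ (1 + √2) * l := by nlinarith
  have h3 : ¬ l * (x + √2) ≤ (2 + √2) * l := by nlinarith
  rw [Gam, if_neg h1, if_neg h2, if_neg h3]

theorem integral_priceDensity_two : ∫ u in (0)..2, priceDensity u = 1 := by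
  rw [integral_priceDensity_high one_le_two le_rfl]
  obtain ⟨k1, k2, k3⟩ := sqrt_two_bounds
  have : 0 < 1 + √2 + 1 := by positivity
  field_simp
  nlinarith

theorem integrable_priceDensity : Integrable priceDensity := by
  have h := intervalIntegrable_priceDensity 0 2
  rw [intervalIntegrable_iff, uIoc_of_le zero_le_two] at h
  refine (integrableOn_iff_integrable_of_support_subset ?_).1 h
  intro x hx
  by_contra h'
  refine hx ?_
  rcases le_or_gt x 0 with h | h
  · exact priceDensity_of_nonpos h
  · exact priceDensity_of_gt (by by_contra h2; exact h' ⟨h, by linarith⟩)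

theorem setIntegral_priceDensity {x : ℝ} (hx : 0 ≤ x) :
    ∫ u in Iic x, priceDensity u = ∫ u in (0)..x, priceDensity u := by
  rw [intervalIntegral.integral_of_le hx]
  refine setIntegral_eq_of_subset_of_forall_sdiff_eq_zero measurableSet_Iic Ioc_subset_Iic_self ?_
  intro s hs
  refine priceDensity_of_nonpos ?_
  by_contra h
  exact hs.2 ⟨not_le.1 h, hs.1⟩

theorem gam_eq_integral {l : ℝ} (hl : 0 < l) (x : ℝ) :
    ∫ u in Iic x, priceDensity u = Gam l (l * (x + √2)) := by
  rcases lt_or_ge x 0 with h | h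
  · rw [gam_of_neg hl h, setIntegral_eq_zero_of_forall_eq_zero]
    intro u hu
    exact priceDensity_of_nonpos (le_trans hu h.le)
  rw [setIntegral_priceDensity h]
  rcases le_or_gt x 1 with h1 | h1
  · rw [gam_low hl h h1, integral_priceDensity_low h h1]
  rcases le_or_gt x 2 with h2 | h2
  · rw [gam_high hl h1.le h2, integral_priceDensity_high h1.le h2]
  · rw [gam_of_gt hl h2, ← intervalIntegral.integral_add_adjacent_intervals (b := 2)
      (intervalIntegrable_priceDensity _ _) (intervalIntegrable_priceDensity _ _),
      integral_priceDensity_two, intervalIntegral.integral_congr_ae (g := fun _ => 0)]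
    · simp
    · refine Eventually.of_forall fun u hu => ?_
      rw [uIoc_of_le h2.le] at hu
      exact priceDensity_of_gt hu.1

theorem integral_priceDensity : ∫ x, priceDensity x = 1 := by
  rw [← integral_priceDensity_two, intervalIntegral.integral_of_le zero_le_two]
  refine (setIntegral_eq_integral_of_forall_compl_eq_zero fun x hx => ?_).symm
  rcases le_or_gt x 0 with h | h
  · exact priceDensity_of_nonpos h
  · exact priceDensity_of_gt (by by_contra h2; exact hx ⟨h, by linarith⟩)

instance : IsProbabilityMeasure basePriceLaw := by
  constructor
  rw [basePriceLaw, withDensity_apply _ MeasurableSet.univ, setLIntegral_univ,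
    ← ofReal_integral_eq_lintegral_ofReal integrable_priceDensity
      (Eventually.of_forall priceDensity_nonneg), integral_priceDensity, ENNReal.ofReal_one]

theorem basePriceLaw_Iic {l : ℝ} (hl : 0 < l) (x : ℝ) :
    basePriceLaw.real (Iic x) = Gam l (l * (x + √2)) := by
  rw [← gam_eq_integral hl, Measure.real, basePriceLaw, withDensity_apply _ measurableSet_Iic,
    ← ofReal_integral_eq_lintegral_ofReal integrable_priceDensity.integrableOn
      (Eventually.of_forall priceDensity_nonneg), ENNReal.toReal_ofReal]
  exact integral_nonneg priceDensity_nonneg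

instance : NullSingletonClass basePriceLaw :=
  ⟨fun x => withDensity_absolutelyContinuous _ _ (measure_singleton x)⟩

theorem basePriceLaw_ae_mem : ∀ᵐ x ∂basePriceLaw, x ∈ Icc (0 : ℝ) 2 := by
  rw [basePriceLaw, ae_withDensity_iff (by
    exact measurable_priceDensity.ennreal_ofReal)]
  refine Eventually.of_forall fun x hx => ?_
  by_contra h
  refine hx ?_
  rcases le_or_gt x 0 with h0 | h0
  · simp [priceDensity_of_nonpos h0]
  · rw [priceDensity_of_gt, ENNReal.ofReal_zero]
    by_contra h2
    exact h ⟨h0.le, not_lt.1 h2⟩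

/-- The shear `(x, y) ↦ (x, x + y)` preserves area and turns the gap into a coordinate; Fubini then
produces `gapDensity`, and its evenness gives the factor `2`. Integrability comes from the bounded
support of the price density. -/
theorem integral_basePriceLaw_gap {k : ℝ → ℝ} (hk : Continuous k) :
    ∫ z, k |z.1 - z.2| ∂(basePriceLaw.prod basePriceLaw) =
      2 * ∫ s in Ioi 0, gapDensity s * k s := by
  have hm : Measurable fun x => ENNReal.ofReal (priceDensity x) :=
    measurable_priceDensity.ennreal_ofReal
  have ep : basePriceLaw.prod basePriceLaw = (volume : Measure (ℝ × ℝ)).withDensity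
      fun z => ENNReal.ofReal (priceDensity z.1 * priceDensity z.2) := by
    simp only [ENNReal.ofReal_mul (priceDensity_nonneg _)]
    exact prod_withDensity hm hm
  have hm2 : Measurable fun z : ℝ × ℝ => priceDensity z.1 * priceDensity z.2 :=
    (measurable_priceDensity.comp measurable_fst).mul (measurable_priceDensity.comp measurable_snd)
  have hint : Integrable (fun z : ℝ × ℝ => priceDensity z.1 * priceDensity z.2 * k |z.1 - z.2|) := by
    have h1 : IntegrableOn (fun z : ℝ × ℝ =>
        priceDensity z.1 * priceDensity z.2 * k |z.1 - z.2|) (Icc 0 2 ×ˢ Icc 0 2) := by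
      obtain ⟨M, hM⟩ := (isCompact_Icc (a := (0 : ℝ)) (b := 2)).exists_bound_of_continuousOn
        hk.continuousOn
      refine Measure.integrableOn_of_bounded (M := 4 * M) ?_
        (hm2.mul (hk.measurable.comp (by fun_prop))).aestronglyMeasurable ?_
      · rw [Measure.volume_eq_prod, Measure.prod_prod]
        simp [Real.volume_Icc, ENNReal.mul_eq_top]
      · filter_upwards [ae_restrict_mem (measurableSet_Icc.prod measurableSet_Icc)] with z hz
        have b : |z.1 - z.2| ∈ Icc (0 : ℝ) 2 := by
          refine ⟨abs_nonneg _, abs_le.2 ⟨?_, ?_⟩⟩ <;>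
            linarith [hz.1.1, hz.1.2, hz.2.1, hz.2.2]
        rw [norm_mul, Real.norm_of_nonneg (mul_nonneg (priceDensity_nonneg _)
          (priceDensity_nonneg _))]
        refine mul_le_mul ?_ (hM _ b) (norm_nonneg _) (by norm_num)
        have := mul_le_mul (priceDensity_le_two z.1) (priceDensity_le_two z.2)
          (priceDensity_nonneg _) zero_le_two
        linarith
    refine (integrableOn_iff_integrable_of_support_subset ?_).1 h1
    intro z hz
    have key : ∀ x, priceDensity x ≠ 0 → x ∈ Icc (0 : ℝ) 2 := by
      intro x hx
      refine ⟨?_, ?_⟩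
      · by_contra h; exact hx (priceDensity_of_nonpos (by linarith))
      · by_contra h; exact hx (priceDensity_of_gt (by linarith))
    have h0 := left_ne_zero_of_mul hz
    exact ⟨key _ (left_ne_zero_of_mul h0), key _ (right_ne_zero_of_mul h0)⟩
  have mp : MeasurePreserving (MeasurableEquiv.shearAddRight ℝ)
      (volume : Measure (ℝ × ℝ)) volume := measurePreserving_prod_add volume volume
  have hint2 : Integrable (fun z : ℝ × ℝ =>
      priceDensity z.1 * priceDensity (z.1 + z.2) * k |z.2|) := by
    have := (mp.integrable_comp_emb (MeasurableEquiv.measurableEmbedding _)).2 hint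
    refine this.congr (Eventually.of_forall fun z => ?_)
    change priceDensity z.1 * priceDensity (z.1 + z.2) * k |z.1 - (z.1 + z.2)| = _
    rw [sub_add_cancel_left, abs_neg]
  rw [ep, integral_withDensity_eq_integral_toReal_smul hm2.ennreal_ofReal (by simp)]
  have e1 : ∫ z : ℝ × ℝ, (ENNReal.ofReal (priceDensity z.1 * priceDensity z.2)).toReal •
      k |z.1 - z.2| = ∫ z : ℝ × ℝ, priceDensity z.1 * priceDensity (z.1 + z.2) * k |z.2| := by
    rw [← mp.integral_comp (MeasurableEquiv.measurableEmbedding _)]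
    congr 1; ext z
    change (ENNReal.ofReal (priceDensity z.1 * priceDensity (z.1 + z.2))).toReal •
      k |z.1 - (z.1 + z.2)| = _
    rw [sub_add_cancel_left, abs_neg, ENNReal.toReal_ofReal (mul_nonneg (priceDensity_nonneg _)
          (priceDensity_nonneg _)), smul_eq_mul]
  rw [e1, Measure.volume_eq_prod, integral_prod_symm _ (by rwa [← Measure.volume_eq_prod])]
  have e2 : ∀ y : ℝ, ∫ x, priceDensity x * priceDensity (x + y) * k |y| =
      gapDensity |y| * k |y| := by
    intro y
    rw [integral_mul_const]
    congr 1
    rcases abs_cases y with ⟨h, -⟩ | ⟨h, -⟩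
    · rw [h, gapDensity]
    · rw [h, gapDensity_neg, gapDensity]
  simp only [e2]
  exact integral_comp_abs (f := fun s => gapDensity s * k s)

/-- The equilibrium distribution of prices. -/
def priceLaw (l : ℝ) : Measure ℝ := basePriceLaw.map fun x => l * (x + √2)

instance (l : ℝ) : IsProbabilityMeasure (priceLaw l) :=
  Measure.isProbabilityMeasure_map (by fun_prop)

theorem priceLaw_Iic {l : ℝ} (hl : 0 < l) (p : ℝ) : (priceLaw l).real (Iic p) = Gam l p := by
  have h : (fun x => l * (x + √2)) ⁻¹' Iic p = Iic (p / l - √2) := by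
    ext x
    simp only [mem_preimage, mem_Iic]
    rw [le_sub_iff_add_le, le_div_iff₀ hl, mul_comm]
  rw [priceLaw, map_measureReal_apply (by fun_prop) measurableSet_Iic, h, basePriceLaw_Iic hl]
  congr 1
  field_simp
  ring

theorem priceLaw_singleton {l : ℝ} (hl : 0 < l) (p : ℝ) : priceLaw l {p} = 0 := by
  rw [priceLaw, Measure.map_apply (by fun_prop) (measurableSet_singleton p)]
  refine Set.Subsingleton.measure_zero ?_ _
  intro x hx y hy
  have : l * (x + √2) = l * (y + √2) := by rw [mem_preimage] at hx hy; exact hx.trans hy.symm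
  linarith [mul_left_cancel₀ hl.ne' this]

theorem priceLaw_ae_mem {l : ℝ} (hl : 0 < l) :
    ∀ᵐ p ∂priceLaw l, p ∈ Icc (√2 * l) ((2 + √2) * l) := by
  refine (ae_map_iff (by fun_prop) measurableSet_Icc).2 ?_
  filter_upwards [basePriceLaw_ae_mem] with x hx
  constructor <;> nlinarith [hx.1, hx.2]

theorem isPricing_priceLaw {l : ℝ} (hl : 0 < l) : IsPricing (priceLaw l) where
  prob := inferInstance
  finiteMean := by
    refine Integrable.of_bound (by fun_prop) ((2 + √2) * l) ?_
    filter_upwards [priceLaw_ae_mem hl] with p hp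
    rw [Real.norm_of_nonneg (le_trans (by positivity) hp.1)]
    exact hp.2

theorem integral_max_priceLaw {l : ℝ} (hl : 0 < l) (t : ℝ) :
    ∫ p, max t |p.1 - p.2| ∂((priceLaw l).prod (priceLaw l)) =
      2 * (l * gapPotential (t / l)) := by
  have hf : Measurable fun x : ℝ => l * (x + √2) := by fun_prop
  rw [priceLaw, Measure.map_prod_map _ _ hf hf, integral_map (by fun_prop)
    (Continuous.aestronglyMeasurable (by fun_prop)), gapPotential,
    mul_left_comm, ← integral_basePriceLaw_gap (k := fun s => max (t / l) s) (by fun_prop),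
    ← integral_const_mul]
  congr 1; ext z
  rw [mul_max_of_nonneg _ _ hl.le, mul_div_cancel₀ _ hl.ne', Prod.map_fst, Prod.map_snd,
    ← mul_sub, abs_mul, abs_of_pos hl, add_sub_add_right_eq_sub]

/-! ### The cost of information -/

/-- The cost integrand as a function of one coordinate. -/
def marginalCost (φ : ℝ → ℝ) (s : ℝ) : ℝ := cost φ (s, 1 / 2)

theorem marginalCost_one_sub (φ : ℝ → ℝ) (x : ℝ) :
    marginalCost φ (1 - x) = marginalCost φ x := by
  simp [marginalCost, cost]; ring

theorem deriv_marginalCost_one_sub (φ : ℝ → ℝ) (x : ℝ) :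
    deriv (marginalCost φ) (1 - x) = -deriv (marginalCost φ) x := by
  have h := deriv_comp_const_sub (f := marginalCost φ) (1 : ℝ) x
  simp only [marginalCost_one_sub] at h
  rw [h, neg_neg]

theorem deriv_marginalCost_half (φ : ℝ → ℝ) : deriv (marginalCost φ) (1 / 2) = 0 := by
  have h := deriv_marginalCost_one_sub φ (1 / 2)
  rw [show (1 : ℝ) - 1 / 2 = 1 / 2 by norm_num] at h
  linarith

/-- The normalization `φ (1 / 2) = 0` removes what the frozen second coordinate would add to
`marginalCost`. -/
theorem IsCostShape.cost_eq {φ : ℝ → ℝ} (hφ : IsCostShape φ) (v : ℝ × ℝ) :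
    cost φ v = marginalCost φ v.1 + marginalCost φ v.2 := by
  have h := hφ.half
  simp only [marginalCost, cost]
  rw [show (1 : ℝ) - 1 / 2 = 1 / 2 by norm_num, h]
  ring

theorem IsCostShape.strictConvexOn {φ : ℝ → ℝ} (hφ : IsCostShape φ) :
    StrictConvexOn ℝ (Ioo 0 1) (marginalCost φ) := by
  refine ⟨convex_Ioo 0 1, fun x hx y hy hxy a b ha hb hab => ?_⟩
  have hh : (1 / 2 : ℝ) ∈ Ioo (0 : ℝ) 1 := by constructor <;> norm_num
  have := hφ.strictConvex.2 (x := (x, 1 / 2)) (y := (y, 1 / 2)) ⟨hx, hh⟩ ⟨hy, hh⟩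
    (fun h => hxy (congrArg Prod.fst h)) ha hb hab
  have e : a • (x, (1 / 2 : ℝ)) + b • (y, (1 / 2 : ℝ)) = (a • x + b • y, 1 / 2) := by
    ext
    · simp
    · simp [← add_mul, hab]
  rwa [e] at this

theorem IsCostShape.differentiableAt {φ : ℝ → ℝ} (hφ : IsCostShape φ) {x : ℝ}
    (hx : x ∈ Ioo (0 : ℝ) 1) : DifferentiableAt ℝ (marginalCost φ) x := by
  have := hφ.thriceDifferentiable 0 (by norm_num) x hx (1 / 2) (by constructor <;> norm_num)
  rwa [iteratedDeriv_zero] at this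

theorem IsCostShape.differentiableAt_deriv {φ : ℝ → ℝ} (hφ : IsCostShape φ) {x : ℝ}
    (hx : x ∈ Ioo (0 : ℝ) 1) : DifferentiableAt ℝ (deriv (marginalCost φ)) x := by
  have := hφ.thriceDifferentiable 1 (by norm_num) x hx (1 / 2) (by constructor <;> norm_num)
  rwa [iteratedDeriv_one] at this

theorem IsCostShape.differentiableAt_deriv_deriv {φ : ℝ → ℝ} (hφ : IsCostShape φ) {x : ℝ}
    (hx : x ∈ Ioo (0 : ℝ) 1) : DifferentiableAt ℝ (deriv (deriv (marginalCost φ))) x := by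
  have := hφ.thriceDifferentiable 2 (by norm_num) x hx (1 / 2) (by constructor <;> norm_num)
  rwa [iteratedDeriv_succ, iteratedDeriv_one] at this

theorem IsCostShape.concaveOn_deriv {φ : ℝ → ℝ} (hφ : IsCostShape φ) :
    ConcaveOn ℝ (Ioc 0 (1 / 2)) (deriv (marginalCost φ)) := by
  have sub : Ioc (0 : ℝ) (1 / 2) ⊆ Ioo 0 1 := fun x hx => ⟨hx.1, by linarith [hx.2]⟩
  refine concaveOn_of_deriv2_nonpos' (convex_Ioc 0 (1 / 2))
    (fun x hx => (hφ.differentiableAt_deriv (sub hx)).differentiableWithinAt)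
    (fun x hx => (hφ.differentiableAt_deriv_deriv (sub hx)).differentiableWithinAt)
    fun x hx => ?_
  have := hφ.third_nonpos x hx (1 / 2) (by constructor <;> norm_num)
  rwa [iteratedDeriv_succ, iteratedDeriv_succ, iteratedDeriv_one] at this

/-- The marginal cost of spreading the posterior means along the antidiagonal. -/
def spreadSlope (φ : ℝ → ℝ) (t : ℝ) : ℝ := -deriv (marginalCost φ) ((1 - t) / 2)

theorem spreadSlope_zero (φ : ℝ → ℝ) : spreadSlope φ 0 = 0 := by
  simp only [spreadSlope, sub_zero]
  rw [deriv_marginalCost_half, neg_zero]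

theorem half_sub_mem {t : ℝ} (ht : t ∈ Ico (0 : ℝ) 1) : (1 - t) / 2 ∈ Ioc (0 : ℝ) (1 / 2) :=
  ⟨by linarith [ht.2], by linarith [ht.1]⟩

theorem half_sub_mem_Ioo {t : ℝ} (ht : t ∈ Ico (0 : ℝ) 1) : (1 - t) / 2 ∈ Ioo (0 : ℝ) 1 :=
  ⟨by linarith [ht.2], by linarith [ht.1]⟩

theorem IsCostShape.continuousOn_spreadSlope {φ : ℝ → ℝ} (hφ : IsCostShape φ) :
    ContinuousOn (spreadSlope φ) (Ico 0 1) := by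
  intro t ht
  have h := (hφ.differentiableAt_deriv (half_sub_mem_Ioo ht)).continuousAt
  refine ContinuousAt.continuousWithinAt (ContinuousAt.neg ?_)
  exact ContinuousAt.comp (f := fun t : ℝ => (1 - t) / 2) h (by fun_prop)

theorem IsCostShape.spreadSlope_pos {φ : ℝ → ℝ} (hφ : IsCostShape φ) {t : ℝ}
    (ht : t ∈ Ioo (0 : ℝ) 1) : 0 < spreadSlope φ t := by
  have h := hφ.strictConvexOn.strictMonoOn_deriv
    (fun x hx => hφ.differentiableAt hx)
  have := h (a := (1 - t) / 2) (b := 1 / 2) (half_sub_mem_Ioo ⟨ht.1.le, ht.2⟩)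
    (by constructor <;> norm_num) (by linarith [ht.1])
  rw [deriv_marginalCost_half] at this
  exact neg_pos.2 this

/-- The sign of the third derivative makes the derivative of `marginalCost` concave on `(0, 1 / 2]`,
so `spreadSlope` is convex. As it vanishes at zero, its ratio to `t` is nondecreasing. -/
theorem IsCostShape.spreadSlope_mul_le {φ : ℝ → ℝ} (hφ : IsCostShape φ) {t s : ℝ}
    (ht : 0 ≤ t) (hts : t ≤ s) (hs : s < 1) :
    s * spreadSlope φ t ≤ t * spreadSlope φ s := by
  rcases hts.eq_or_lt with rfl | hlt
  · exact le_rfl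
  have hs0 : 0 < s := ht.trans_lt hlt
  have hc := hφ.concaveOn_deriv.2
  have h := hc (half_sub_mem (t := s) ⟨hs0.le, hs⟩)
    (half_sub_mem (t := 0) ⟨le_rfl, zero_lt_one⟩) (a := t / s) (b := 1 - t / s) (by positivity)
    (by rw [sub_nonneg, div_le_one hs0]; exact hts) (by ring)
  have e : (t / s) • ((1 - s) / 2) + (1 - t / s) • ((1 - 0) / 2) = (1 - t) / 2 := by
    simp only [smul_eq_mul]
    field_simp
    ring
  rw [e] at h
  have h0 := spreadSlope_zero φ
  simp only [spreadSlope, neg_eq_zero] at h0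
  rw [h0, smul_zero, add_zero, smul_eq_mul, div_mul_eq_mul_div, div_le_iff₀ hs0] at h
  simp only [spreadSlope]
  linarith

/-- The cost minus the parabola has derivative `(l * spreadSlope φ t - t * spreadSlope φ l) / (2 *
l)`, which is nonpositive before `l` and nonnegative after it by `spreadSlope_mul_le`. So its
minimum is at `t = l`. -/
theorem IsCostShape.marginalCost_spread_ge {φ : ℝ → ℝ} (hφ : IsCostShape φ) {l t : ℝ}
    (hl : l ∈ Ioo (0 : ℝ) 1) (ht : t ∈ Ico (0 : ℝ) 1) :
    marginalCost φ ((1 - l) / 2) + spreadSlope φ l / (4 * l) * (t ^ 2 - l ^ 2) ≤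
      marginalCost φ ((1 - t) / 2) := by
  set q : ℝ → ℝ := fun t => marginalCost φ ((1 - t) / 2) - spreadSlope φ l / (4 * l) * t ^ 2 with hq
  have hl0 := hl.1
  have hd : ∀ t ∈ Ico (0 : ℝ) 1, HasDerivAt q
      ((l * spreadSlope φ t - t * spreadSlope φ l) / (2 * l)) t := by
    intro t ht
    have h1 := (hφ.differentiableAt (half_sub_mem_Ioo ht)).hasDerivAt
    have h2 : HasDerivAt (fun t : ℝ => (1 - t) / 2) (-1 / 2) t :=
      ((hasDerivAt_id t).const_sub 1).div_const 2
    have h3 := (h1.comp t h2).sub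
      ((hasDerivAt_pow 2 t).const_mul (spreadSlope φ l / (4 * l)))
    refine h3.congr_deriv ?_
    simp only [spreadSlope]
    field_simp
    ring
  have hc : ContinuousOn q (Ico 0 1) := fun t ht => (hd t ht).continuousAt.continuousWithinAt
  suffices q l ≤ q t by simp only [hq] at this; linarith
  rcases le_total t l with h | h
  · have := antitoneOn_of_deriv_nonpos (convex_Icc 0 l) (f := q)
      (hc.mono fun x hx => ⟨hx.1, hx.2.trans_lt hl.2⟩) ?_ ?_
    · exact this ⟨ht.1, h⟩ ⟨hl0.le, le_rfl⟩ h
    · intro x hx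
      rw [interior_Icc] at hx
      exact (hd x ⟨hx.1.le, hx.2.trans hl.2⟩).differentiableAt.differentiableWithinAt
    · intro x hx
      rw [interior_Icc] at hx
      rw [(hd x ⟨hx.1.le, hx.2.trans hl.2⟩).deriv]
      refine div_nonpos_of_nonpos_of_nonneg ?_ (by positivity)
      linarith [hφ.spreadSlope_mul_le hx.1.le hx.2.le hl.2]
  · have := monotoneOn_of_deriv_nonneg (convex_Ico l 1) (f := q)
      (hc.mono fun x hx => ⟨hl0.le.trans hx.1, hx.2⟩) ?_ ?_
    · exact this ⟨le_rfl, hl.2⟩ ⟨h, ht.2⟩ h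
    · intro x hx
      rw [interior_Ico] at hx
      exact (hd x ⟨(hl0.trans hx.1).le, hx.2⟩).differentiableAt.differentiableWithinAt
    · intro x hx
      rw [interior_Ico] at hx
      rw [(hd x ⟨(hl0.trans hx.1).le, hx.2⟩).deriv]
      refine div_nonneg ?_ (by positivity)
      linarith [hφ.spreadSlope_mul_le hl0.le hx.1.le hx.2]

/-- Reflect the first coordinate, which leaves its cost unchanged, and apply midpoint convexity to
`1 - v.1` and `v.2`. -/
theorem IsCostShape.cost_ge {φ : ℝ → ℝ} (hφ : IsCostShape φ) {v : ℝ × ℝ}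
    (hv : v ∈ Ioo (0 : ℝ) 1 ×ˢ Ioo (0 : ℝ) 1) :
    2 * marginalCost φ ((1 - |v.1 - v.2|) / 2) ≤ cost φ v := by
  have h1 : 1 - v.1 ∈ Ioo (0 : ℝ) 1 := ⟨by linarith [hv.1.2], by linarith [hv.1.1]⟩
  have hc := hφ.strictConvexOn.convexOn.2
  have h := hc h1 hv.2 (a := 1 / 2) (b := 1 / 2) (by norm_num)
    (by norm_num) (by norm_num)
  have e1 : (1 / 2 : ℝ) • (1 - v.1) + (1 / 2 : ℝ) • v.2 = (1 - (v.1 - v.2)) / 2 := by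
    simp only [smul_eq_mul]; ring
  have e2 : marginalCost φ ((1 - |v.1 - v.2|) / 2) = marginalCost φ ((1 - (v.1 - v.2)) / 2) := by
    rcases abs_cases (v.1 - v.2) with ⟨h, -⟩ | ⟨h, -⟩
    · rw [h]
    · rw [h, ← marginalCost_one_sub]
      congr 1; ring
  rw [e1, marginalCost_one_sub] at h
  rw [e2, hφ.cost_eq]
  simp only [smul_eq_mul] at h
  linarith

/-! ### Fusions -/

theorem measurableSet_square : MeasurableSet square := measurableSet_Icc.prod measurableSet_Icc

theorem isCompact_square : IsCompact square := isCompact_Icc.prod isCompact_Icc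

/-- On the event that the conditional expectation is nonpositive, the positive variable `X` has
nonpositive integral, so that event is null. Strictness keeps posterior means off the boundary of
the square, where nothing is assumed about the cost. -/
theorem condExp_pos {Ω : Type*} {m m0 : MeasurableSpace Ω} {μ : Measure Ω} [IsProbabilityMeasure μ]
    (hm : m ≤ m0) {X : Ω → ℝ} (hX : Integrable X μ) (hpos : ∀ᵐ w ∂μ, 0 < X w) :
    ∀ᵐ w ∂μ, 0 < (μ[X | m]) w := by
  set s : Set Ω := {w | (μ[X | m]) w ≤ 0} with hs
  have hsm : MeasurableSet[m] s :=
    (stronglyMeasurable_condExp (μ := μ) (m := m) (f := X)).measurable measurableSet_Iic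
  have h1 : ∫ w in s, X w ∂μ ≤ 0 := by
    rw [← setIntegral_condExp hm hX hsm]
    exact setIntegral_nonpos (hm s hsm) fun w hw => hw
  have h0 : 0 ≤ᵐ[μ.restrict s] X := ae_restrict_of_ae (hpos.mono fun w hw => hw.le)
  have h2 : ∫ w in s, X w ∂μ = 0 := le_antisymm h1 (integral_nonneg_of_ae h0)
  rw [integral_eq_zero_iff_of_nonneg_ae h0 hX.integrableOn] at h2
  have h3 : ∀ᵐ w ∂μ.restrict s, False := by
    filter_upwards [h2, ae_restrict_of_ae hpos] with w hw hw'
    exact hw'.ne' hw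
  have h4 : μ s = 0 := by
    simpa [ae_iff] using h3
  rw [ae_iff]
  simpa [hs] using h4

theorem IsPriorDensity.aemeasurable {h : ℝ × ℝ → ℝ} (hh : IsPriorDensity h) :
    AEMeasurable h (volume.restrict square) :=
  hh.continuousOn.aemeasurable measurableSet_square

theorem IsPriorDensity.integral_prior {h : ℝ × ℝ → ℝ} (hh : IsPriorDensity h) (f : ℝ × ℝ → ℝ) :
    ∫ z, f z ∂prior h = ∫ z in square, h z * f z := by
  rw [prior, integral_withDensity_eq_integral_toReal_smul₀ hh.aemeasurable.ennreal_ofReal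
    (by simp)]
  refine setIntegral_congr_fun measurableSet_square fun z hz => ?_
  simp [ENNReal.toReal_ofReal (hh.pos z hz).le]

theorem IsPriorDensity.integrable {h : ℝ × ℝ → ℝ} (hh : IsPriorDensity h) :
    IntegrableOn h square := hh.continuousOn.integrableOn_compact isCompact_square

theorem IsPriorDensity.isProbabilityMeasure {h : ℝ × ℝ → ℝ} (hh : IsPriorDensity h) :
    IsProbabilityMeasure (prior h) := by
  constructor
  rw [prior, withDensity_apply _ MeasurableSet.univ, setLIntegral_univ,
    ← ofReal_integral_eq_lintegral_ofReal hh.integrable, hh.total, ENNReal.ofReal_one]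
  filter_upwards [ae_restrict_mem measurableSet_square] with z hz using (hh.pos z hz).le

theorem ae_fst_ne (c : ℝ) : ∀ᵐ z : ℝ × ℝ, z.1 ≠ c :=
  Measure.quasiMeasurePreserving_fst.ae (Measure.ae_ne volume c)

theorem ae_snd_ne (c : ℝ) : ∀ᵐ z : ℝ × ℝ, z.2 ≠ c :=
  Measure.quasiMeasurePreserving_snd.ae (Measure.ae_ne volume c)

theorem prior_ae_mem (h : ℝ × ℝ → ℝ) :
    ∀ᵐ z ∂prior h, z ∈ Ioo (0 : ℝ) 1 ×ˢ Ioo (0 : ℝ) 1 := by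
  refine (withDensity_absolutelyContinuous _ _).ae_le ?_
  filter_upwards [ae_restrict_mem measurableSet_square, ae_restrict_of_ae (ae_fst_ne 0),
    ae_restrict_of_ae (ae_fst_ne 1), ae_restrict_of_ae (ae_snd_ne 0),
    ae_restrict_of_ae (ae_snd_ne 1)] with z hz h1 h2 h3 h4
  exact ⟨⟨hz.1.1.lt_of_ne' h1, hz.1.2.lt_of_ne h2⟩, ⟨hz.2.1.lt_of_ne' h3, hz.2.2.lt_of_ne h4⟩⟩

theorem IsPriorDensity.integral_fst {h : ℝ × ℝ → ℝ} (hh : IsPriorDensity h) :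
    ∫ z, z.1 ∂prior h = 1 / 2 := by
  rw [hh.integral_prior, ← hh.mean]
  simp only [mul_comm]

theorem IsPriorDensity.integral_snd {h : ℝ × ℝ → ℝ} (hh : IsPriorDensity h) :
    ∫ z, z.2 ∂prior h = 1 / 2 := by
  rw [hh.integral_prior, ← hh.mean]
  have mp : MeasurePreserving (MeasurableEquiv.prodComm : ℝ × ℝ ≃ᵐ ℝ × ℝ) volume volume :=
    Measure.measurePreserving_swap
  have e := mp.setIntegral_preimage_emb (MeasurableEquiv.measurableEmbedding _)
    (fun z : ℝ × ℝ => h z * z.2) square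
  have e2 : (MeasurableEquiv.prodComm : ℝ × ℝ ≃ᵐ ℝ × ℝ) ⁻¹' square = square := by
    ext z
    exact and_comm
  rw [e2] at e
  rw [← e]
  refine setIntegral_congr_fun measurableSet_square fun z hz => ?_
  change h (z.2, z.1) * z.1 = z.1 * h z
  rw [hh.symm z hz, mul_comm]

/-- Posterior means stay in the open unit square and average to the prior mean. -/
theorem IsFusion.spec {H F : Measure (ℝ × ℝ)} [IsProbabilityMeasure H] (hF : IsFusion H F)
    (hH : ∀ᵐ z ∂H, z ∈ Ioo (0 : ℝ) 1 ×ˢ Ioo (0 : ℝ) 1) :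
    IsProbabilityMeasure F ∧ (∀ᵐ v ∂F, v ∈ Ioo (0 : ℝ) 1 ×ˢ Ioo (0 : ℝ) 1) ∧
      ∫ v, v.1 ∂F = ∫ z, z.1 ∂H ∧ ∫ v, v.2 ∂F = ∫ z, z.2 ∂H := by
  obtain ⟨S, mS, K, hK, rfl⟩ := hF
  set μ := H ⊗ₘ K with hμ
  have hm : MeasurableSpace.comap (Prod.snd : (ℝ × ℝ) × S → S) mS ≤ Prod.instMeasurableSpace :=
    measurable_snd.comap_le
  have hfst : μ.map Prod.fst = H := by
    have := Measure.fst_compProd H K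
    rwa [Measure.fst] at this
  have hmem : ∀ᵐ w ∂μ, w.1 ∈ Ioo (0 : ℝ) 1 ×ˢ Ioo (0 : ℝ) 1 :=
    ae_of_ae_map measurable_fst.aemeasurable (by rw [hfst]; exact hH)
  have hX : Integrable (fun w : (ℝ × ℝ) × S => w.1.1) μ := by
    refine Integrable.of_bound (by fun_prop) 1 ?_
    filter_upwards [hmem] with w hw
    rw [Real.norm_of_nonneg hw.1.1.le]
    exact hw.1.2.le
  have hY : Integrable (fun w : (ℝ × ℝ) × S => w.1.2) μ := by
    refine Integrable.of_bound (by fun_prop) 1 ?_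
    filter_upwards [hmem] with w hw
    rw [Real.norm_of_nonneg hw.2.1.le]
    exact hw.2.2.le
  have sX := (stronglyMeasurable_condExp (μ := μ) (m := MeasurableSpace.comap Prod.snd mS)
    (f := fun w : (ℝ × ℝ) × S => w.1.1)).mono hm
  have sY := (stronglyMeasurable_condExp (μ := μ) (m := MeasurableSpace.comap Prod.snd mS)
    (f := fun w : (ℝ × ℝ) × S => w.1.2)).mono hm
  have hmeas := sX.measurable.prodMk sY.measurable
  have key : ∀ {Z : (ℝ × ℝ) × S → ℝ}, Integrable Z μ → (∀ᵐ w ∂μ, Z w ∈ Ioo (0 : ℝ) 1) →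
      ∀ᵐ w ∂μ, (μ[Z | MeasurableSpace.comap Prod.snd mS]) w ∈ Ioo (0 : ℝ) 1 := by
    intro Z hZ hZm
    have c1 := condExp_pos hm hZ (hZm.mono fun w hw => hw.1)
    have c2 := condExp_pos hm ((integrable_const (1 : ℝ)).sub hZ)
      (hZm.mono fun w hw => sub_pos.2 hw.2)
    have c3 := condExp_sub (integrable_const (1 : ℝ)) hZ
      (MeasurableSpace.comap Prod.snd mS)
    rw [condExp_const hm] at c3
    filter_upwards [c1, c2, c3] with w h1 h2 h3
    rw [h3] at h2
    exact ⟨h1, sub_pos.1 h2⟩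
  refine ⟨Measure.isProbabilityMeasure_map hmeas.aemeasurable, ?_, ?_, ?_⟩
  · refine (ae_map_iff hmeas.aemeasurable (measurableSet_Ioo.prod measurableSet_Ioo)).2 ?_
    filter_upwards [key hX (hmem.mono fun w hw => hw.1), key hY (hmem.mono fun w hw => hw.2)]
      with w h1 h2 using ⟨h1, h2⟩
  · rw [integral_map hmeas.aemeasurable (by fun_prop)]
    simp only
    rw [integral_condExp hm, ← hfst, integral_map (by fun_prop) (by fun_prop)]
  · rw [integral_map hmeas.aemeasurable (by fun_prop)]
    simp only
    rw [integral_condExp hm, ← hfst, integral_map (by fun_prop) (by fun_prop)]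

/-- The signal that says `true` with probability `q z`. -/
def binarySignal (q : ℝ × ℝ → ℝ) (hq : Measurable q) : Kernel (ℝ × ℝ) Bool where
  toFun z := ENNReal.ofReal (q z) • Measure.dirac true +
    ENNReal.ofReal (1 - q z) • Measure.dirac false
  measurable' := by
    refine Measure.measurable_of_measurable_coe _ fun s hs => ?_
    simp only [Measure.add_apply, Measure.smul_apply, smul_eq_mul]
    fun_prop

theorem binarySignal_apply (q : ℝ × ℝ → ℝ) (hq : Measurable q) (z : ℝ × ℝ) :
    binarySignal q hq z = ENNReal.ofReal (q z) • Measure.dirac true +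
      ENNReal.ofReal (1 - q z) • Measure.dirac false := rfl

theorem isMarkovKernel_binarySignal {q : ℝ × ℝ → ℝ} (hq : Measurable q)
    (h01 : ∀ z, q z ∈ Icc (0 : ℝ) 1) : IsMarkovKernel (binarySignal q hq) := by
  refine ⟨fun z => ⟨?_⟩⟩
  simp only [binarySignal_apply, Measure.add_apply, Measure.smul_apply, measure_univ, smul_eq_mul,
    mul_one]
  rw [← ENNReal.ofReal_add (h01 z).1 (sub_nonneg.2 (h01 z).2), add_sub_cancel, ENNReal.ofReal_one]

theorem integral_binarySignal {q : ℝ × ℝ → ℝ} (hq : Measurable q)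
    (h01 : ∀ z, q z ∈ Icc (0 : ℝ) 1) (z : ℝ × ℝ) (f : Bool → ℝ) :
    ∫ b, f b ∂binarySignal q hq z = q z * f true + (1 - q z) * f false := by
  rw [binarySignal_apply, integral_add_measure, integral_smul_measure, integral_smul_measure,
    integral_dirac, integral_dirac, ENNReal.toReal_ofReal (h01 z).1,
    ENNReal.toReal_ofReal (sub_nonneg.2 (h01 z).2), smul_eq_mul, smul_eq_mul]
  · exact (Integrable.of_finite).smul_measure ENNReal.ofReal_ne_top
  · exact (Integrable.of_finite).smul_measure ENNReal.ofReal_ne_top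

/-- The signal's sigma-algebra has the two atoms `true` and `false`; `ht` and `hn` are the defining
equations of the conditional expectation on them, and every other event is a union of atoms. -/
theorem condExp_binarySignal {H : Measure (ℝ × ℝ)} [IsProbabilityMeasure H] {q : ℝ × ℝ → ℝ}
    (hq : Measurable q) (h01 : ∀ z, q z ∈ Icc (0 : ℝ) 1) {f : ℝ × ℝ → ℝ} (hf : Measurable f)
    (hf1 : ∀ᵐ z ∂H, ‖f z‖ ≤ 1) (g : Bool → ℝ) (ht : ∫ z, q z * (f z - g true) ∂H = 0)
    (hn : ∫ z, (1 - q z) * (f z - g false) ∂H = 0) :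
    (fun w : (ℝ × ℝ) × Bool => g w.2) =ᵐ[H ⊗ₘ binarySignal q hq]
      (H ⊗ₘ binarySignal q hq)[fun w : (ℝ × ℝ) × Bool => f w.1 |
        MeasurableSpace.comap Prod.snd inferInstance] := by
  have := isMarkovKernel_binarySignal hq h01
  set μ := H ⊗ₘ binarySignal q hq with hμ
  have hm : MeasurableSpace.comap (Prod.snd : (ℝ × ℝ) × Bool → Bool) inferInstance ≤
    Prod.instMeasurableSpace := measurable_snd.comap_le
  have hfst : μ.map Prod.fst = H := by
    have := Measure.fst_compProd H (binarySignal q hq)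
    rwa [Measure.fst] at this
  have hfm : ∀ᵐ w ∂μ, ‖f w.1‖ ≤ 1 :=
    ae_of_ae_map measurable_fst.aemeasurable (by rw [hfst]; exact hf1)
  have hfi : Integrable (fun w : (ℝ × ℝ) × Bool => f w.1) μ :=
    Integrable.of_bound (hf.comp measurable_fst).aestronglyMeasurable 1 hfm
  have hg : Measurable g := measurable_of_finite g
  have hgi : Integrable (fun w : (ℝ × ℝ) × Bool => g w.2) μ := by
    refine Integrable.of_bound (by fun_prop) (max ‖g true‖ ‖g false‖)
      (Eventually.of_forall fun w => ?_)
    cases w.2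
    · exact le_max_right _ _
    · exact le_max_left _ _
  refine ae_eq_condExp_of_forall_setIntegral_eq hm hfi (fun s _ _ => hgi.integrableOn) ?_ ?_
  · rintro s ⟨B, -, rfl⟩ -
    have hB : MeasurableSet (Prod.snd ⁻¹' B : Set ((ℝ × ℝ) × Bool)) :=
      measurable_snd (MeasurableSet.of_discrete)
    rw [← sub_eq_zero, ← integral_sub hgi.integrableOn hfi.integrableOn,
      ← integral_indicator hB]
    have hi : Integrable ((Prod.snd ⁻¹' B : Set ((ℝ × ℝ) × Bool)).indicator
      fun w => g w.2 - f w.1) μ := (hgi.sub hfi).indicator hB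
    rw [hμ, Measure.integral_compProd hi]
    simp only [integral_binarySignal hq h01]
    have hqi : Integrable (fun z => q z * (f z - g true)) H := by
      refine Integrable.of_bound (by fun_prop) (1 + ‖g true‖) ?_
      filter_upwards [hf1] with z hz
      rw [norm_mul]
      have h1 : ‖q z‖ ≤ 1 := by rw [Real.norm_of_nonneg (h01 z).1]; exact (h01 z).2
      have h2 := norm_sub_le (f z) (g true)
      nlinarith [norm_nonneg (q z), norm_nonneg (f z - g true)]
    have hqi' : Integrable (fun z => (1 - q z) * (f z - g false)) H := by
      refine Integrable.of_bound (by fun_prop) (1 + ‖g false‖) ?_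
      filter_upwards [hf1] with z hz
      rw [norm_mul]
      have h1 : ‖1 - q z‖ ≤ 1 := by
        rw [Real.norm_of_nonneg (sub_nonneg.2 (h01 z).2)]; linarith [(h01 z).1]
      have h2 := norm_sub_le (f z) (g false)
      nlinarith [norm_nonneg (1 - q z), norm_nonneg (f z - g false)]
    have e : ∀ z : ℝ × ℝ, q z * (Prod.snd ⁻¹' B : Set ((ℝ × ℝ) × Bool)).indicator
        (fun w => g w.2 - f w.1) (z, true) + (1 - q z) *
        (Prod.snd ⁻¹' B : Set ((ℝ × ℝ) × Bool)).indicator (fun w => g w.2 - f w.1) (z, false) =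
        (-B.indicator 1 true) * (q z * (f z - g true)) +
          (-B.indicator 1 false) * ((1 - q z) * (f z - g false)) := by
      intro z
      by_cases h1 : true ∈ B <;> by_cases h2 : false ∈ B <;> simp [indicator, h1, h2] <;> ring
    simp only [e]
    rw [integral_add (hqi.const_mul _) (hqi'.const_mul _), integral_const_mul, integral_const_mul,
      ht, hn]
    simp
  · have h1 : Measurable[MeasurableSpace.comap (Prod.snd : (ℝ × ℝ) × Bool → Bool) inferInstance]
        (fun w : (ℝ × ℝ) × Bool => g w.2) := hg.comp (comap_measurable _)
    exact h1.stronglyMeasurable.aestronglyMeasurable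

theorem map_binarySignal {H : Measure (ℝ × ℝ)} [IsProbabilityMeasure H] {q : ℝ × ℝ → ℝ}
    (hq : Measurable q) (h01 : ∀ z, q z ∈ Icc (0 : ℝ) 1) (hi : ∫ z, q z ∂H = 1 / 2)
    (g : Bool → ℝ × ℝ) :
    (H ⊗ₘ binarySignal q hq).map (fun w => g w.2) =
      (2⁻¹ : ENNReal) • Measure.dirac (g false) + (2⁻¹ : ENNReal) • Measure.dirac (g true) := by
  have := isMarkovKernel_binarySignal hq h01
  have hg : Measurable g := measurable_of_finite g
  have hint : Integrable q H := by
    refine Integrable.of_bound (by fun_prop) 1 (Eventually.of_forall fun z => ?_)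
    rw [Real.norm_of_nonneg (h01 z).1]
    exact (h01 z).2
  have e1 : ∫⁻ z, ENNReal.ofReal (q z) ∂H = 2⁻¹ := by
    rw [← ofReal_integral_eq_lintegral_ofReal hint (Eventually.of_forall fun z => (h01 z).1), hi]
    rw [one_div, ENNReal.ofReal_inv_of_pos two_pos, ENNReal.ofReal_ofNat]
  have hint' : Integrable (fun z => 1 - q z) H := (integrable_const 1).sub hint
  have e2 : ∫⁻ z, ENNReal.ofReal (1 - q z) ∂H = 2⁻¹ := by
    rw [← ofReal_integral_eq_lintegral_ofReal hint'
      (Eventually.of_forall fun z => sub_nonneg.2 (h01 z).2),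
      integral_sub (integrable_const 1) hint, hi]
    simp only [integral_const, probReal_univ, smul_eq_mul, mul_one]
    rw [show (1 : ℝ) - 1 / 2 = 2⁻¹ by norm_num, ENNReal.ofReal_inv_of_pos two_pos,
      ENNReal.ofReal_ofNat]
  ext s hs
  have hgs : Measurable fun w : (ℝ × ℝ) × Bool => g w.2 := hg.comp measurable_snd
  have hpre : MeasurableSet ((fun w : (ℝ × ℝ) × Bool => g w.2) ⁻¹' s) := hgs hs
  rw [Measure.map_apply hgs hs, Measure.compProd_apply hpre]
  have e3 : ∀ z : ℝ × ℝ, binarySignal q hq z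
      (Prod.mk z ⁻¹' ((fun w : (ℝ × ℝ) × Bool => g w.2) ⁻¹' s)) =
      ENNReal.ofReal (q z) * s.indicator 1 (g true) +
        ENNReal.ofReal (1 - q z) * s.indicator 1 (g false) := by
    intro z
    have : Prod.mk z ⁻¹' ((fun w : (ℝ × ℝ) × Bool => g w.2) ⁻¹' s) = g ⁻¹' s := rfl
    rw [this, binarySignal_apply]
    simp only [Measure.add_apply, Measure.smul_apply, smul_eq_mul,
      Measure.dirac_apply' _ (hg hs)]
    rfl
  simp only [e3]
  rw [lintegral_add_left (by fun_prop), lintegral_mul_const _ (by fun_prop),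
    lintegral_mul_const _ (by fun_prop), e1, e2]
  simp only [Measure.add_apply, Measure.smul_apply, smul_eq_mul, Measure.dirac_apply' _ hs]
  rw [add_comm]

theorem setIntegral_square_mul (f g : ℝ → ℝ) :
    ∫ z in square, f z.1 * g z.2 = (∫ x in (0)..1, f x) * ∫ y in (0)..1, g y := by
  rw [square, Measure.volume_eq_prod, setIntegral_prod_mul, integral_Icc_eq_integral_Ioc,
    integral_Icc_eq_integral_Ioc, intervalIntegral.integral_of_le zero_le_one,
    intervalIntegral.integral_of_le zero_le_one]

theorem integrableOn_square {f : ℝ × ℝ → ℝ} (hf : Continuous f) : IntegrableOn f square :=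
  hf.continuousOn.integrableOn_compact isCompact_square

theorem setIntegral_square_sub : ∫ z in square, (z.1 - z.2) = 0 := by
  rw [integral_sub (integrableOn_square (by fun_prop)) (integrableOn_square (by fun_prop))]
  have h1 := setIntegral_square_mul (fun x => x) (fun _ => 1)
  have h2 := setIntegral_square_mul (fun _ => 1) (fun x => x)
  simp only [mul_one, one_mul] at h1 h2
  rw [h1, h2]
  simp

theorem setIntegral_square_sub_mul_fst : ∫ z in square, (z.1 - z.2) * z.1 = 1 / 12 := by
  have h1 := setIntegral_square_mul (fun x => x ^ 2) (fun _ => 1)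
  have h2 := setIntegral_square_mul (fun x => x) (fun x => x)
  have e : ∀ z : ℝ × ℝ, (z.1 - z.2) * z.1 = z.1 ^ 2 * 1 - z.1 * z.2 := fun z => by ring
  simp only [e]
  rw [integral_sub (integrableOn_square (by fun_prop)) (integrableOn_square (by fun_prop)), h1, h2]
  simp
  norm_num

theorem setIntegral_square_sub_mul_snd : ∫ z in square, (z.1 - z.2) * z.2 = -(1 / 12) := by
  have h1 := setIntegral_square_mul (fun _ => 1) (fun x => x ^ 2)
  have h2 := setIntegral_square_mul (fun x => x) (fun x => x)
  have e : ∀ z : ℝ × ℝ, (z.1 - z.2) * z.2 = z.1 * z.2 - 1 * z.2 ^ 2 := fun z => by ring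
  simp only [e]
  rw [integral_sub (integrableOn_square (by fun_prop)) (integrableOn_square (by fun_prop)), h1, h2]
  simp
  norm_num

theorem IsPriorDensity.exists_lower_bound {h : ℝ × ℝ → ℝ} (hh : IsPriorDensity h) :
    ∃ d : ℝ, 0 < d ∧ ∀ z ∈ square, d ≤ h z := by
  obtain ⟨z0, hz0, hmin⟩ := isCompact_square.exists_isMinOn
    ⟨(0, 0), ⟨le_rfl, zero_le_one⟩, ⟨le_rfl, zero_le_one⟩⟩ hh.continuousOn
  exact ⟨h z0, hh.pos z0 hz0, fun z hz => hmin hz⟩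

theorem IsPriorDensity.isFusion_twoPoint {h : ℝ × ℝ → ℝ} (hh : IsPriorDensity h) {d : ℝ}
    (hdh : ∀ z ∈ square, d ≤ h z) {l : ℝ} (hl : 0 < l) (hld : 6 * l ≤ d) :
    IsFusion (prior h) (twoPoint l) := by
  classical
  have := hh.isProbabilityMeasure
  -- Dividing by `h` turns moments of the tilt under the prior into moments under the uniform law,
  -- so the shape of `h` drops out. Since the integral of `(z.1 - z.2) * z.1` over the square is `1
  -- / 12`, the factor `3 * l` moves the posterior means to `(1 ± l) / 2`. The bound `6 * l ≤ d`
  -- keeps `q` in `[0, 1]`.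
  set q : ℝ × ℝ → ℝ := square.piecewise (fun z => 1 / 2 + 3 * l * (z.1 - z.2) / h z)
    (fun _ => 1 / 2) with hq_def
  have hq : Measurable q := by
    refine ContinuousOn.measurable_piecewise ?_ continuousOn_const measurableSet_square
    exact continuousOn_const.add (ContinuousOn.div (by fun_prop) hh.continuousOn
      fun z hz => (hh.pos z hz).ne')
  have h01 : ∀ z, q z ∈ Icc (0 : ℝ) 1 := by
    intro z
    by_cases hz : z ∈ square
    · have hp := hh.pos z hz
      have hb := hdh z hz
      have e : q z = 1 / 2 + 3 * l * (z.1 - z.2) / h z := piecewise_eq_of_mem _ _ _ hz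
      obtain ⟨⟨a1, a2⟩, a3, a4⟩ := hz
      have u : 3 * l * (z.1 - z.2) / h z ≤ 1 / 2 := by
        rw [div_le_iff₀ hp]; nlinarith
      have lo : -(1 / 2) ≤ 3 * l * (z.1 - z.2) / h z := by
        rw [le_div_iff₀ hp]; nlinarith
      rw [e]
      constructor <;> linarith
    · have e : q z = 1 / 2 := piecewise_eq_of_notMem _ _ _ hz
      rw [e]
      constructor <;> norm_num
  have hint : ∀ f : ℝ × ℝ → ℝ, Continuous f → ∫ z, q z * f z ∂prior h =
      (∫ z, f z ∂prior h) / 2 + 3 * l * ∫ z in square, (z.1 - z.2) * f z := by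
    intro f hf
    rw [hh.integral_prior, hh.integral_prior, ← integral_div, ← integral_const_mul,
      ← integral_add]
    · refine setIntegral_congr_fun measurableSet_square fun z hz => ?_
      have e : q z = 1 / 2 + 3 * l * (z.1 - z.2) / h z := piecewise_eq_of_mem _ _ _ hz
      have hp := hh.pos z hz
      simp only [e]
      field_simp
    · exact ((hh.continuousOn.mul hf.continuousOn).integrableOn_compact isCompact_square).div_const _
    · exact (integrableOn_square (by fun_prop)).const_mul _
  have i1 : ∫ z, q z ∂prior h = 1 / 2 := by
    have := hint (fun _ => 1) continuous_const
    simp only [mul_one, setIntegral_square_sub] at this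
    simpa using this
  have iX := hint (fun z => z.1) continuous_fst
  have iY := hint (fun z => z.2) continuous_snd
  rw [hh.integral_fst, setIntegral_square_sub_mul_fst] at iX
  rw [hh.integral_snd, setIntegral_square_sub_mul_snd] at iY
  have bX : ∀ᵐ z ∂prior h, ‖z.1‖ ≤ 1 := by
    filter_upwards [prior_ae_mem h] with z hz
    rw [Real.norm_of_nonneg hz.1.1.le]
    exact hz.1.2.le
  have bY : ∀ᵐ z ∂prior h, ‖z.2‖ ≤ 1 := by
    filter_upwards [prior_ae_mem h] with z hz
    rw [Real.norm_of_nonneg hz.2.1.le]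
    exact hz.2.2.le
  have bq : ∀ᵐ z ∂prior h, ‖q z‖ ≤ 1 := Eventually.of_forall fun z => by
    rw [Real.norm_of_nonneg (h01 z).1]
    exact (h01 z).2
  have nq : Integrable q (prior h) := Integrable.of_bound (by fun_prop) 1 bq
  have nX : Integrable (fun z : ℝ × ℝ => z.1) (prior h) := Integrable.of_bound (by fun_prop) 1 bX
  have nY : Integrable (fun z : ℝ × ℝ => z.2) (prior h) := Integrable.of_bound (by fun_prop) 1 bY
  have split : ∀ f : ℝ × ℝ → ℝ, Integrable f (prior h) → ∀ c : ℝ,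
      (∫ z, q z * (f z - c) ∂prior h = (∫ z, q z * f z ∂prior h) - c / 2) ∧
      ∫ z, (1 - q z) * (f z - c) ∂prior h =
        (∫ z, f z ∂prior h) - (∫ z, q z * f z ∂prior h) - c / 2 := by
    intro f hf c
    have nqf : Integrable (fun z => q z * f z) (prior h) := hf.bdd_mul (by fun_prop) bq
    have e1 : ∀ z, q z * (f z - c) = q z * f z - q z * c := fun z => by ring
    have e2 : ∀ z, (1 - q z) * (f z - c) = (f z - q z * f z) - (c - q z * c) := fun z => by ring
    have n1 : Integrable (fun z => f z - q z * f z) (prior h) := hf.sub nqf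
    have n2 : Integrable (fun z => c - q z * c) (prior h) :=
      (integrable_const c).sub (nq.mul_const c)
    simp only [e1, e2]
    rw [integral_sub nqf (nq.mul_const c), integral_sub n1 n2, integral_sub hf nqf,
      integral_sub (integrable_const c) (nq.mul_const c), integral_mul_const, i1]
    simp only [integral_const, probReal_univ, smul_eq_mul]
    constructor <;> ring
  let g : Bool → ℝ × ℝ := fun b => if b then ((1 + l) / 2, (1 - l) / 2) else
    ((1 - l) / 2, (1 + l) / 2)
  have gt : g true = ((1 + l) / 2, (1 - l) / 2) := rfl
  have gf : g false = ((1 - l) / 2, (1 + l) / 2) := rfl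
  refine ⟨Bool, inferInstance, binarySignal q hq, isMarkovKernel_binarySignal hq h01, ?_⟩
  have c1 := condExp_binarySignal hq h01 (f := fun z => z.1) measurable_fst bX (fun b => (g b).1)
    (by rw [(split _ nX _).1, iX, gt]; ring)
    (by rw [(split _ nX _).2, iX, hh.integral_fst, gf]; ring)
  have c2 := condExp_binarySignal hq h01 (f := fun z => z.2) measurable_snd bY (fun b => (g b).2)
    (by rw [(split _ nY _).1, iY, gt]; ring)
    (by rw [(split _ nY _).2, iY, hh.integral_snd, gf]; ring)
  have em := map_binarySignal (H := prior h) hq h01 i1 g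
  rw [twoPoint, ← gt, ← gf, ← em]
  refine Measure.map_congr ?_
  filter_upwards [c1, c2] with w h1 h2
  exact Prod.ext h1 h2

/-! ### Pricing -/

theorem one_sub_gam_of_nonpos {l x : ℝ} (hl : 0 < l) (hx : x ≤ 0) :
    1 - Gam l (l * (x + √2)) = 1 := by
  rcases hx.lt_or_eq with h | rfl
  · rw [gam_of_neg hl h, sub_zero]
  · rw [gam_low hl le_rfl zero_le_one]; simp

theorem one_sub_gam_low {l x : ℝ} (hl : 0 < l) (hx : 0 ≤ x) (hx1 : x ≤ 1) :
    1 - Gam l (l * (x + √2)) = (1 + √2) / (1 + √2 + x) := by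
  rw [gam_low hl hx hx1]
  have : 0 < 1 + √2 + x := by positivity
  field_simp
  ring

theorem one_sub_gam_high {l x : ℝ} (hl : 0 < l) (hx : 1 ≤ x) (hx1 : x ≤ 2) :
    1 - Gam l (l * (x + √2)) = (2 - x) / (√2 + x - 1) := by
  rw [gam_high hl hx hx1]
  obtain ⟨k1, k2, k3⟩ := sqrt_two_bounds
  generalize √2 = r at *
  have hr : 0 < r := by linarith
  have p1 : 0 < r + (x - 1) := by linarith
  have p2 : 0 < r + x - 1 := by linarith
  have p3 : 0 < 1 + r + 1 := by linarith
  rw [div_add_div _ _ p3.ne' (by positivity), one_sub_div (by positivity),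
    div_eq_div_iff (by positivity) p2.ne']
  have hr2 : r ^ 2 = 2 := by nlinarith
  have hr3 : r ^ 3 = 2 * r := by rw [pow_succ, hr2]
  have hr4 : r ^ 4 = 4 := by rw [show r ^ 4 = (r ^ 2) ^ 2 by ring, hr2]; norm_num
  ring_nf
  rw [hr2, hr3, hr4]
  ring

theorem one_sub_gam_of_ge {l x : ℝ} (hl : 0 < l) (hx : 2 ≤ x) :
    1 - Gam l (l * (x + √2)) = 0 := by
  rcases hx.eq_or_lt with rfl | h
  · rw [one_sub_gam_high hl one_le_two le_rfl]; simp
  · rw [gam_of_gt hl h, sub_self]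

/-- In the units `x = p / l - √2`, a price in the lower half of the support always sells to the
consumer who favours the firm, and to the other one according to the upper branch of `Gam`. A price
in the upper half sells only to the favourable consumer, according to the lower branch. Each branch
cancels the factor `x + √2`; outside `[0, 2]` quadratic or linear estimates suffice. -/
theorem revenue_le {l : ℝ} (hl : 0 < l) (p : ℝ) :
    p * (((1 - Gam l (p + l)) + (1 - Gam l (p - l))) / 2) ≤ (1 + √2) * l / 2 ∧
    (p ∈ Icc (√2 * l) ((2 + √2) * l) →
      p * (((1 - Gam l (p + l)) + (1 - Gam l (p - l))) / 2) = (1 + √2) * l / 2) := by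
  obtain ⟨x, rfl⟩ : ∃ x, p = l * (x + √2) := ⟨p / l - √2, by field_simp; ring⟩
  rw [show l * (x + √2) + l = l * (x + 1 + √2) by ring,
    show l * (x + √2) - l = l * (x - 1 + √2) by ring]
  have hmem : l * (x + √2) ∈ Icc (√2 * l) ((2 + √2) * l) ↔ x ∈ Icc (0 : ℝ) 2 := by
    constructor
    · rintro ⟨h1, h2⟩
      constructor
      · by_contra h; nlinarith
      · by_contra h; nlinarith
    · rintro ⟨h1, h2⟩
      constructor <;> nlinarith
  rw [hmem]
  have red : ∀ D : ℝ, l * (x + √2) * (D / 2) = l / 2 * ((x + √2) * D) := fun D => by ring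
  have red' : (1 + √2) * l / 2 = l / 2 * (1 + √2) := by ring
  rw [red, red']
  have hl2 : 0 < l / 2 := by positivity
  suffices H : (x + √2) * (1 - Gam l (l * (x + 1 + √2)) + (1 - Gam l (l * (x - 1 + √2)))) ≤ 1 + √2 ∧
      (x ∈ Icc (0 : ℝ) 2 →
        (x + √2) * (1 - Gam l (l * (x + 1 + √2)) + (1 - Gam l (l * (x - 1 + √2)))) = 1 + √2) from
    ⟨mul_le_mul_of_nonneg_left H.1 hl2.le, fun h => by rw [H.2 h]⟩
  obtain ⟨k1, k2, k3⟩ := sqrt_two_bounds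
  rcases le_or_gt x (-1) with h1 | h1
  · rw [one_sub_gam_of_nonpos hl (by linarith), one_sub_gam_of_nonpos hl (by linarith)]
    refine ⟨by linarith, fun h => ?_⟩
    linarith [h.1]
  rcases lt_or_ge x 0 with h2 | h2
  · rw [one_sub_gam_low hl (by linarith) (by linarith), one_sub_gam_of_nonpos hl (by linarith)]
    refine ⟨?_, fun h => absurd h.1 (by linarith)⟩
    have hp : 0 < 1 + √2 + (x + 1) := by linarith
    rw [div_add_one hp.ne', ← mul_div_assoc, div_le_iff₀ hp]
    nlinarith
  rcases le_or_gt x 1 with h3 | h3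
  · rw [one_sub_gam_high hl (by linarith) (by linarith), one_sub_gam_of_nonpos hl (by linarith)]
    have hp : 0 < √2 + (x + 1) - 1 := by linarith
    have e : (x + √2) * ((2 - (x + 1)) / (√2 + (x + 1) - 1) + 1) = 1 + √2 := by
      rw [div_add_one hp.ne', ← mul_div_assoc, div_eq_iff hp.ne']
      ring
    exact ⟨e.le, fun _ => e⟩
  rcases le_or_gt x 2 with h4 | h4
  · rw [one_sub_gam_of_ge hl (by linarith), one_sub_gam_low hl (by linarith) (by linarith)]
    have hp : 0 < 1 + √2 + (x - 1) := by linarith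
    have e : (x + √2) * (0 + (1 + √2) / (1 + √2 + (x - 1))) = 1 + √2 := by
      rw [zero_add, ← mul_div_assoc, div_eq_iff hp.ne']
      ring
    exact ⟨e.le, fun _ => e⟩
  refine ⟨?_, fun h => absurd h.2 (by linarith)⟩
  rw [one_sub_gam_of_ge hl (by linarith), zero_add]
  rcases le_or_gt x 3 with h5 | h5
  · rw [one_sub_gam_high hl (by linarith) (by linarith)]
    have hp : 0 < √2 + (x - 1) - 1 := by linarith
    rw [← mul_div_assoc, div_le_iff₀ hp]
    nlinarith
  · rw [one_sub_gam_of_ge hl (by linarith), mul_zero]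
    linarith

theorem integral_twoPoint (l : ℝ) (f : ℝ × ℝ → ℝ) :
    ∫ v, f v ∂twoPoint l =
      (f ((1 - l) / 2, (1 + l) / 2) + f ((1 + l) / 2, (1 - l) / 2)) / 2 := by
  have hi : ∀ a : ℝ × ℝ, Integrable f ((2⁻¹ : ENNReal) • Measure.dirac a) := fun a =>
    (integrable_dirac enorm_lt_top).smul_measure (by simp)
  rw [twoPoint, integral_add_measure (hi _) (hi _), integral_smul_measure, integral_smul_measure,
    integral_dirac, integral_dirac]
  simp
  ring

theorem integrable_twoPoint (l : ℝ) (f : ℝ × ℝ → ℝ) : Integrable f (twoPoint l) := by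
  have hi : ∀ a : ℝ × ℝ, Integrable f ((2⁻¹ : ENNReal) • Measure.dirac a) := fun a =>
    (integrable_dirac enorm_lt_top).smul_measure (by simp)
  exact (hi _).add_measure (hi _)

theorem IsPurchaseRule.integral_priceLaw {σ : ℝ × ℝ → ℝ × ℝ → ℝ} (hσ : IsPurchaseRule σ) {l : ℝ}
    (hl : 0 < l) (v : ℝ × ℝ) (p : ℝ) :
    ∫ p₂, σ v (p, p₂) ∂priceLaw l = 1 - Gam l (p - (v.1 - v.2)) := by
  have e : (fun p₂ => σ v (p, p₂)) =ᵐ[priceLaw l] (Ioi (p - (v.1 - v.2))).indicator 1 := by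
    have h0 : ∀ᵐ p₂ ∂priceLaw l, p₂ ≠ p - (v.1 - v.2) := by
      rw [ae_iff]; simpa using priceLaw_singleton hl _
    filter_upwards [h0] with p₂ hp
    rcases lt_or_gt_of_ne hp with h | h
    · rw [hσ.buy_two v (p, p₂) (by simp only; linarith), indicator_of_notMem (by simp; linarith)]
    · rw [hσ.buy_one v (p, p₂) (by simp only; linarith), indicator_of_mem (by simpa using h)]
      rfl
  rw [integral_congr_ae e, integral_indicator_one measurableSet_Ioi, ← compl_Iic,
    probReal_compl_eq_one_sub measurableSet_Iic, priceLaw_Iic hl]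

theorem IsPurchaseRule.profit₁_eq {σ : ℝ × ℝ → ℝ × ℝ → ℝ} (hσ : IsPurchaseRule σ) {l : ℝ}
    (hl : 0 < l) (G : Measure ℝ) :
    profit₁ σ (twoPoint l) G (priceLaw l) =
      ∫ p, p * (((1 - Gam l (p + l)) + (1 - Gam l (p - l))) / 2) ∂G := by
  unfold profit₁
  congr 1; ext p
  rw [integral_twoPoint, hσ.integral_priceLaw hl, hσ.integral_priceLaw hl]
  congr 5 <;> simp only <;> ring

theorem IsPurchaseRule.profit₁_le {σ : ℝ × ℝ → ℝ × ℝ → ℝ} (hσ : IsPurchaseRule σ) {l : ℝ}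
    (hl : 0 < l) {G : Measure ℝ} (hG : IsPricing G) :
    profit₁ σ (twoPoint l) G (priceLaw l) ≤ profit₁ σ (twoPoint l) (priceLaw l) (priceLaw l) := by
  have := hG.prob
  have e : profit₁ σ (twoPoint l) (priceLaw l) (priceLaw l) = (1 + √2) * l / 2 := by
    rw [hσ.profit₁_eq hl, integral_congr_ae (g := fun _ => (1 + √2) * l / 2)]
    · simp
    · filter_upwards [priceLaw_ae_mem hl] with p hp using (revenue_le hl p).2 hp
  rw [e, hσ.profit₁_eq hl]
  by_cases hi : Integrable
      (fun p => p * (((1 - Gam l (p + l)) + (1 - Gam l (p - l))) / 2)) G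
  · refine (integral_mono hi (integrable_const _) fun p => (revenue_le hl p).1).trans ?_
    simp
  -- If the integral took its default value `0`, it would still lie below the positive equilibrium
  -- profit.
  · rw [integral_undef hi]
    positivity

/-- The purchase rule seen from the other firm. -/
def swapRule (σ : ℝ × ℝ → ℝ × ℝ → ℝ) (v p : ℝ × ℝ) : ℝ := 1 - σ v.swap p.swap

theorem IsPurchaseRule.swap {σ : ℝ × ℝ → ℝ × ℝ → ℝ} (hσ : IsPurchaseRule σ) :
    IsPurchaseRule (swapRule σ) where
  measurable := by
    have : Measurable fun w : (ℝ × ℝ) × ℝ × ℝ => (w.1.swap, w.2.swap) := by fun_prop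
    exact measurable_const.sub (hσ.measurable.comp this)
  mem_Icc v p := ⟨sub_nonneg.2 (hσ.mem_Icc _ _).2, sub_le_self _ (hσ.mem_Icc _ _).1⟩
  buy_one v p h := by rw [swapRule, hσ.buy_two _ _ h, sub_zero]
  buy_two v p h := by rw [swapRule, hσ.buy_one _ _ h, sub_self]

theorem profit₂_twoPoint (σ : ℝ × ℝ → ℝ × ℝ → ℝ) (l : ℝ) (G₁ G₂ : Measure ℝ) :
    profit₂ σ (twoPoint l) G₁ G₂ = profit₁ (swapRule σ) (twoPoint l) G₂ G₁ := by
  unfold profit₁ profit₂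
  congr 1; ext p
  -- Exchanging the firms exchanges the two atoms, which have equal weight.
  rw [integral_twoPoint, integral_twoPoint, add_comm]
  rfl

/-! ### The consumer's reduced form utility -/

/-- The consumer obtains the larger net value, written as half the sum plus half the distance. At a
tie both are equal, so the tie-breaking probability drops out. -/
theorem IsPurchaseRule.net_value {σ : ℝ × ℝ → ℝ × ℝ → ℝ} (hσ : IsPurchaseRule σ) (v p : ℝ × ℝ) :
    σ v p * (v.1 - p.1) + (1 - σ v p) * (v.2 - p.2) =
      (v.1 + v.2) / 2 - (p.1 + p.2) / 2 + |(v.1 - v.2) - (p.1 - p.2)| / 2 := by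
  rcases lt_trichotomy (v.1 - p.1) (v.2 - p.2) with h | h | h
  · rw [hσ.buy_two v p h, abs_of_neg (by linarith)]; ring
  · rw [show (v.1 - v.2) - (p.1 - p.2) = 0 by linarith, h, abs_zero]
    linarith
  · rw [hσ.buy_one v p h, abs_of_pos (by linarith)]; ring

theorem IsPurchaseRule.grossUtility_eq {σ : ℝ × ℝ → ℝ × ℝ → ℝ} (hσ : IsPurchaseRule σ) {l : ℝ}
    (hl : 0 < l) (v : ℝ × ℝ) :
    grossUtility σ (priceLaw l) (priceLaw l) v =
      (v.1 + v.2) / 2 - (∫ p, p ∂priceLaw l) + l * gapPotential (|v.1 - v.2| / l) := by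
  set G := priceLaw l with hG
  have i1 : Integrable (fun p : ℝ × ℝ => p.1) (G.prod G) := (isPricing_priceLaw hl).finiteMean.comp_fst G
  have i2 : Integrable (fun p : ℝ × ℝ => p.2) (G.prod G) := (isPricing_priceLaw hl).finiteMean.comp_snd G
  have i3 : Integrable (fun p : ℝ × ℝ => |(v.1 - v.2) - (p.1 - p.2)|) (G.prod G) :=
    ((integrable_const (v.1 - v.2)).sub (i1.sub i2)).abs
  have i4 : Integrable (fun p : ℝ × ℝ => |(v.1 - v.2) - (p.2 - p.1)|) (G.prod G) :=
    ((integrable_const (v.1 - v.2)).sub (i2.sub i1)).abs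
  have e1 : ∫ p, p.1 ∂(G.prod G) = ∫ p, p ∂G := by
    rw [integral_fun_fst (f := fun p : ℝ => p)]; simp
  have e2 : ∫ p, p.2 ∂(G.prod G) = ∫ p, p ∂G := by
    rw [integral_fun_snd (f := fun p : ℝ => p)]; simp
  have e3 : ∫ p, |(v.1 - v.2) - (p.2 - p.1)| ∂(G.prod G) =
      ∫ p, |(v.1 - v.2) - (p.1 - p.2)| ∂(G.prod G) :=
    integral_prod_swap (μ := G) (ν := G) (fun p : ℝ × ℝ => |(v.1 - v.2) - (p.1 - p.2)|)
  -- Averaging over the exchange of the two prices replaces `|t - d|` by `(|t - d| + |t + d|) / 2 =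
  -- max |t| |d|`.
  have e4 : (∫ p, |(v.1 - v.2) - (p.1 - p.2)| ∂(G.prod G)) +
      ∫ p, |(v.1 - v.2) - (p.2 - p.1)| ∂(G.prod G) =
      2 * ∫ p, max |v.1 - v.2| |p.1 - p.2| ∂(G.prod G) := by
    rw [← integral_add i3 i4, ← integral_const_mul]
    congr 1; ext p
    generalize v.1 - v.2 = t
    rw [← neg_sub p.1 p.2]
    generalize p.1 - p.2 = d
    rcases abs_cases (t - d) with ⟨h1, _⟩ | ⟨h1, _⟩ <;>
      rcases abs_cases (t - -d) with ⟨h2, _⟩ | ⟨h2, _⟩ <;>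
      rcases abs_cases t with ⟨h3, _⟩ | ⟨h3, _⟩ <;>
      rcases abs_cases d with ⟨h4, _⟩ | ⟨h4, _⟩ <;>
      rcases max_cases |t| |d| with ⟨h5, _⟩ | ⟨h5, _⟩ <;>
      linarith
  rw [integral_max_priceLaw hl] at e4
  unfold grossUtility
  simp only [hσ.net_value]
  have i5 : Integrable (fun p : ℝ × ℝ => (p.1 + p.2) / 2) (G.prod G) := (i1.add i2).div_const 2
  have i6 : Integrable (fun p : ℝ × ℝ => (v.1 + v.2) / 2 - (p.1 + p.2) / 2) (G.prod G) :=
    (integrable_const _).sub i5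
  rw [integral_add i6 (i3.div_const 2), integral_sub (integrable_const _) i5, integral_const,
    integral_div, integral_div, integral_add i1 i2, e1, e2]
  simp only [probReal_univ, smul_eq_mul]
  linarith

theorem measurable_gapPotential : Measurable gapPotential := by
  have h : StronglyMeasurable (Function.uncurry fun t s : ℝ => gapDensity s * max t s) := by
    refine Measurable.stronglyMeasurable ?_
    exact (measurable_gapDensity.comp measurable_snd).mul (measurable_fst.max measurable_snd)
  exact (h.integral_prod_right (ν := volume.restrict (Ioi (0 : ℝ)))).measurable

theorem gapPotential_nonneg (t : ℝ) : 0 ≤ gapPotential t := by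
  refine setIntegral_nonneg measurableSet_Ioi fun s hs => ?_
  exact mul_nonneg (gapDensity_nonneg s) (le_max_of_le_right (le_of_lt hs))

theorem integrable_gapPotential {F : Measure (ℝ × ℝ)} [IsProbabilityMeasure F]
    (hF : ∀ᵐ v ∂F, v ∈ Ioo (0 : ℝ) 1 ×ˢ Ioo (0 : ℝ) 1) {l : ℝ} (hl : 0 < l) :
    Integrable (fun v : ℝ × ℝ => l * gapPotential (|v.1 - v.2| / l)) F := by
  have hm : Measurable fun v : ℝ × ℝ => gapPotential (|v.1 - v.2| / l) :=
    measurable_gapPotential.comp (by fun_prop)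
  refine (Integrable.of_bound hm.aestronglyMeasurable
    (gapPotential 1 + gapMass / 2 * ((1 / l) ^ 2)) ?_).const_mul l
  filter_upwards [hF] with v hv
  rw [Real.norm_of_nonneg (gapPotential_nonneg _)]
  have h1 : |v.1 - v.2| ≤ 1 :=
    abs_le.2 ⟨by linarith [hv.1.1, hv.2.2], by linarith [hv.1.2, hv.2.1]⟩
  refine (gapPotential_le (by positivity)).trans ?_
  have h2 : |v.1 - v.2| / l ≤ 1 / l := by gcongr
  have h3 : (|v.1 - v.2| / l) ^ 2 ≤ (1 / l) ^ 2 := by gcongr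
  have := gapMass_pos
  nlinarith

theorem consumer_optimal {φ : ℝ → ℝ} (hφ : IsCostShape φ) {h : ℝ × ℝ → ℝ} (hh : IsPriorDensity h)
    {κ l : ℝ} (hκ : 0 < κ) (hl : l ∈ Ioo (0 : ℝ) 1) (hfoc : κ * spreadSlope φ l = gapMass)
    {σ : ℝ × ℝ → ℝ × ℝ → ℝ} (hσ : IsPurchaseRule σ) {F : Measure (ℝ × ℝ)}
    (hF : IsFusion (prior h) F) (hc : Integrable (cost φ) F) :
    consumerPayoff φ κ σ (priceLaw l) (priceLaw l) F ≤
      consumerPayoff φ κ σ (priceLaw l) (priceLaw l) (twoPoint l) := by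
  have := hh.isProbabilityMeasure
  obtain ⟨hP, hmem, hX, hY⟩ := hF.spec (prior_ae_mem h)
  rw [hh.integral_fst] at hX
  rw [hh.integral_snd] at hY
  have hl0 := hl.1
  set m := ∫ p, p ∂priceLaw l with hm
  set C := l * gapPotential 1 - κ * (2 * marginalCost φ ((1 - l) / 2)) with hC
  -- The common parabola: the benefit is at most, and the cost at least, its value at `l` plus
  -- `gapMass / (2 * l) * (t ^ 2 - l ^ 2)`. The coefficients agree by `hfoc`, so the `t` terms
  -- cancel.
  have bound : ∀ v ∈ Ioo (0 : ℝ) 1 ×ˢ Ioo (0 : ℝ) 1,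
      grossUtility σ (priceLaw l) (priceLaw l) v - κ * cost φ v ≤ (v.1 + v.2) / 2 - m + C := by
    intro v hv
    rw [hσ.grossUtility_eq hl0, ← hm]
    have ht : |v.1 - v.2| ∈ Ico (0 : ℝ) 1 :=
      ⟨abs_nonneg _, abs_lt.2 ⟨by linarith [hv.1.1, hv.2.2], by linarith [hv.1.2, hv.2.1]⟩⟩
    have h1 := hφ.cost_ge hv
    have h2 := hφ.marginalCost_spread_ge hl ht
    generalize |v.1 - v.2| = t at *
    have h3 := gapPotential_le (t := t / l) (div_nonneg ht.1 hl0.le)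
    have h4 : l * gapPotential (t / l) ≤ l * gapPotential 1 + gapMass / (2 * l) * (t ^ 2 - l ^ 2) := by
      refine (mul_le_mul_of_nonneg_left h3 hl0.le).trans_eq ?_
      field_simp
    have h5 : κ * (2 * (marginalCost φ ((1 - l) / 2) +
        spreadSlope φ l / (4 * l) * (t ^ 2 - l ^ 2))) ≤ κ * cost φ v :=
      mul_le_mul_of_nonneg_left (by linarith) hκ.le
    have h6 : κ * (2 * (marginalCost φ ((1 - l) / 2) +
        spreadSlope φ l / (4 * l) * (t ^ 2 - l ^ 2))) =
        κ * (2 * marginalCost φ ((1 - l) / 2)) + gapMass / (2 * l) * (t ^ 2 - l ^ 2) := by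
      rw [← hfoc]
      field_simp
      ring
    linarith
  have attained : ∀ v : ℝ × ℝ, |v.1 - v.2| = l → v.1 + v.2 = 1 →
      cost φ v = 2 * marginalCost φ ((1 - l) / 2) →
      grossUtility σ (priceLaw l) (priceLaw l) v - κ * cost φ v = 1 / 2 - m + C := by
    intro v h1 h2 h3
    rw [hσ.grossUtility_eq hl0, ← hm, h1, h2, h3, div_self hl0.ne', hC]
    ring
  have hsym : marginalCost φ ((1 + l) / 2) = marginalCost φ ((1 - l) / 2) := by
    rw [← marginalCost_one_sub]; congr 1; ring
  have value : consumerPayoff φ κ σ (priceLaw l) (priceLaw l) (twoPoint l) = 1 / 2 - m + C := by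
    unfold consumerPayoff
    rw [integral_twoPoint, attained, attained]
    · ring
    · rw [show ((1 + l) / 2, (1 - l) / 2).1 - ((1 + l) / 2, (1 - l) / 2).2 = l by simp only; ring,
        abs_of_pos hl0]
    · simp only; ring
    · rw [hφ.cost_eq]; simp only [hsym]; ring
    · rw [show ((1 - l) / 2, (1 + l) / 2).1 - ((1 - l) / 2, (1 + l) / 2).2 = -l by simp only; ring,
        abs_neg, abs_of_pos hl0]
    · simp only; ring
    · rw [hφ.cost_eq]; simp only [hsym]; ring
  have nX : Integrable (fun v : ℝ × ℝ => v.1) F := by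
    refine Integrable.of_bound (by fun_prop) 1 ?_
    filter_upwards [hmem] with v hv
    rw [Real.norm_of_nonneg hv.1.1.le]
    exact hv.1.2.le
  have nY : Integrable (fun v : ℝ × ℝ => v.2) F := by
    refine Integrable.of_bound (by fun_prop) 1 ?_
    filter_upwards [hmem] with v hv
    rw [Real.norm_of_nonneg hv.2.1.le]
    exact hv.2.2.le
  have nL : Integrable (fun v : ℝ × ℝ => (v.1 + v.2) / 2) F := (nX.add nY).div_const 2
  have nLm : Integrable (fun v : ℝ × ℝ => (v.1 + v.2) / 2 - m) F := nL.sub (integrable_const m)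
  have nu : Integrable (grossUtility σ (priceLaw l) (priceLaw l)) F := by
    refine (nLm.add (integrable_gapPotential hmem hl0)).congr (Eventually.of_forall fun v => ?_)
    rw [hσ.grossUtility_eq hl0]
    rfl
  rw [value]
  unfold consumerPayoff
  calc ∫ v, (grossUtility σ (priceLaw l) (priceLaw l) v - κ * cost φ v) ∂F
      ≤ ∫ v, ((v.1 + v.2) / 2 - m + C) ∂F := by
        refine integral_mono_ae (nu.sub (hc.const_mul κ)) (nLm.add (integrable_const C)) ?_
        filter_upwards [hmem] with v hv using bound v hv
    _ = 1 / 2 - m + C := by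
        rw [integral_add nLm (integrable_const C), integral_sub nL (integrable_const m),
          integral_div, integral_add nX nY, hX, hY]
        simp only [integral_const, probReal_univ, smul_eq_mul]
        ring

/-! ### Choice of the spread and assembly of the equilibrium -/

/-- Intermediate value theorem for the continuous `spreadSlope φ`, which vanishes at `0` and is at
least `gapMass / κ` at `l₀` once `κ` is large. The root is not `0` because `gapMass` is positive. -/
theorem exists_spread {φ : ℝ → ℝ} (hφ : IsCostShape φ) {l₀ κ : ℝ} (hl₀ : l₀ ∈ Ioo (0 : ℝ) 1)
    (hκ0 : 0 < κ) (hκ : gapMass / spreadSlope φ l₀ ≤ κ) :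
    ∃ l, 0 < l ∧ l ≤ l₀ ∧ κ * spreadSlope φ l = gapMass := by
  have hs := hφ.spreadSlope_pos hl₀
  have hpos : 0 < gapMass / κ := div_pos gapMass_pos hκ0
  obtain ⟨l, hl, he⟩ := intermediate_value_Icc hl₀.1.le
    (hφ.continuousOn_spreadSlope.mono fun x hx => ⟨hx.1, hx.2.trans_lt hl₀.2⟩)
    (show gapMass / κ ∈ Icc (spreadSlope φ 0) (spreadSlope φ l₀) by
      rw [spreadSlope_zero]
      refine ⟨hpos.le, ?_⟩
      rw [div_le_iff₀ hs] at hκ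
      rw [div_le_iff₀ hκ0]
      linarith)
  refine ⟨l, hl.1.lt_of_ne ?_, hl.2, by rw [he]; field_simp⟩
  rintro rfl
  rw [spreadSlope_zero] at he
  exact hpos.ne he

end CompShop

end

theorem mainTheorem11 (φ : ℝ → ℝ) (hφ : CompShop.IsCostShape φ)
    (h : ℝ × ℝ → ℝ) (hh : CompShop.IsPriorDensity h) :
    ∃ κbar : ℝ, 0 < κbar ∧ ∀ κ : ℝ, κbar ≤ κ →
      ∃ l : ℝ, 0 < l ∧ l ≤ 1 ∧
        ∃ G : Measure ℝ, IsProbabilityMeasure G ∧ (∀ p : ℝ, G.real (Iic p) = CompShop.Gam l p) ∧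
          ∀ σ : ℝ × ℝ → ℝ × ℝ → ℝ, CompShop.IsPurchaseRule σ →
            CompShop.IsEquilibrium φ κ (CompShop.prior h) (CompShop.twoPoint l) G G σ := by
  obtain ⟨d, hd, hdh⟩ := hh.exists_lower_bound
  -- The cap `d / 6` makes the two points a fusion of the prior; `1 / 2` keeps the spread inside
  -- `(0, 1)`. The threshold for `κ` is the one at which the first order condition holds at this
  -- cap.
  have hl₀ : min (d / 6) (1 / 2) ∈ Ioo (0 : ℝ) 1 :=
    ⟨lt_min (by positivity) (by norm_num), (min_le_right _ _).trans_lt (by norm_num)⟩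
  have hκbar := div_pos CompShop.gapMass_pos (hφ.spreadSlope_pos hl₀)
  refine ⟨_, hκbar, fun κ hκ => ?_⟩
  have hκ0 := hκbar.trans_le hκ
  obtain ⟨l, hl, hll, hfoc⟩ := CompShop.exists_spread hφ hl₀ hκ0 hκ
  have hl1 : l < 1 := hll.trans_lt hl₀.2
  have hld : 6 * l ≤ d := by linarith [hll.trans (min_le_left _ _)]
  refine ⟨l, hl, hl1.le, CompShop.priceLaw l, inferInstance, CompShop.priceLaw_Iic hl,
    fun σ hσ => ?_⟩
  exact
    { purchase := hσ
      pricing₁ := CompShop.isPricing_priceLaw hl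
      pricing₂ := CompShop.isPricing_priceLaw hl
      fusion := hh.isFusion_twoPoint hdh hl hld
      finiteCost := CompShop.integrable_twoPoint l _
      learning_optimal := fun F hF hc =>
        CompShop.consumer_optimal hφ hh hκ0 ⟨hl, hl1⟩ hfoc hσ hF hc
      price_optimal₁ := fun G hG => hσ.profit₁_le hl hG
      price_optimal₂ := fun G hG => by
        rw [CompShop.profit₂_twoPoint, CompShop.profit₂_twoPoint]
        exact hσ.swap.profit₁_le hl hG }
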